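/- \textbf{Corollary (Non-Unitary Probability Integral Estimation).} There are universal constants $C>0$ and $k\in\mathbb N$ with the following property. Let $n,b\in\mathbb N$, $X\in\{0,1,\dots,2^n-1\}$, $a_\psi>0$, $\epsilon_\Psi>0$ and $0<\delta<1$. Put $x_j=2j/2^n-1$ and $\hat x=2X/2^n-1$. There is a quantum algorithm, depending only on $(n,b,X,a_\psi,\epsilon_\Psi,\delta)$, for which the following holds. Let $\psi$ be any (unknown) real function that is analytic and strictly positive on $[-1,1]$, with $\int_{-1}^1\psi^2(x)\,dx=1$, and let $\Lambda$ be any number with $|\psi^{(j)}(x)|\le\Lambda^{j+1}$ for $j=0,1,2$ and $x\in[-1,1]$. Suppose that $\epsilon_\Psi\le n\max_{x\in[-1,1]}\psi^2(x)$. Let $$|\psi\rangle=\frac1{\sqrt{\mathcal N}}\sum_{j=0}^{2^n-1}\psi(x_j)|j\rangle,\qquad \mathcal N=\sum_{j=0}^{2^n-1}\psi(x_j)^2,$$ and let $U_\psi$ be any unitary on $n$ main qubits and $b$ ancilla qubits such that $$\langle 0|_a\,U_\psi\,|0\rangle|0\rangle_a=a_\psi|\psi\rangle .$$ Then the algorithm,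 given access to $U_\psi$ and $U_\psi^\dagger$ as black-box gates, returns with probability at least $1-\delta$ a number $\tilde\Psi$ with $$\Bigl|\tilde\Psi-\int_{-1}^{\hat x}\psi^2(x')\,dx'\Bigr|\le\epsilon_\Psi+C\,\frac{\Lambda^2}{2^n}.$$ Its number of uses of $U_\psi$ and $U_\psi^\dagger$ is at most $$C\,F\,\log^k(2+F)\,\log(2/\delta),\qquad F=\frac1{a_\psi}\,\frac{n^2\max_x\psi(x)}{\epsilon_\Psi},$$ that is, $\tilde O\bigl(\frac1{a_\psi}\frac{n^2\max_x\psi(x)}{\epsilon_\Psi}\bigr)$. Its total number of gates (arbitrary unitaries on at most two qubits, and uses of $U_\psi$ or $U_\psi^\dagger$, each counted once) is at most $$C\,G\,\log^k(2+G)\,\log(2/\delta),\qquad G=\frac1{a_\psi}\,\frac{(n^2+b)\max_x\psi(x)}{\epsilon_\Psi};$$ in particular it is $\tilde O\bigl(\frac1{a_\psi}\frac{n^2\max_x\psi(x)}{\epsilon_\Psi}\bigr)$ when $b=O(n^2)$. Here an algorithm consists of finitely many runs. In each run all qubits (main, ancilla and workspace) start in $|0\rangle$, a circuit of such gates is applied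 and all qubits are measured in the computational basis. The choice of the next circuit, and the returned number, may depend on the earlier measurement outcomes. Numbers of gates and of uses are totals over all runs, in the worst case over the measurement outcomes. -/

import Mathlib

open Set

noncomputable section

namespace QEstimation

/-- The grid point `x_j = 2 j / 2 ^ n - 1` of `[-1, 1]`. -/
def gridPoint (n j : ℕ) : ℝ := 2 * (j : ℝ) / 2 ^ n - 1

/-- The integer `j` whose binary digits are held by an `n`-qubit register (`x i` is the digit of
weight `2 ^ i`), so that `|x⟩` is the basis vector `|j⟩`. -/
def regValue {n : ℕ} (x : Fin n → Bool) : ℕ := ∑ i, if x i then 2 ^ (i : ℕ) else 0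

/-- `𝒩 = ∑_j ψ(x_j)²`. -/
def gridNormSq (n : ℕ) (ψ : ℝ → ℝ) : ℝ := ∑ j ∈ Finset.range (2 ^ n), ψ (gridPoint n j) ^ 2

/-- The coordinate of `|ψ⟩ = 𝒩^(-1/2) ∑_j ψ(x_j) |j⟩` at the basis vector `|x⟩`. -/
def encodedState (n : ℕ) (ψ : ℝ → ℝ) (x : Fin n → Bool) : ℝ :=
  ψ (gridPoint n (regValue x)) / Real.sqrt (gridNormSq n ψ)

/-- All qubits of a register in state `0`. -/
def zeroBits (Q : Type) : Q → Bool := fun _ => false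

/-- Operators on the `n` main qubits together with the `b` ancilla qubits, as matrices in the
computational basis. -/
abbrev OracleMatrix (n b : ℕ) : Type := Matrix (Fin n ⊕ Fin b → Bool) (Fin n ⊕ Fin b → Bool) ℂ

/-- `U` is unitary and `⟨0|_a U |0⟩ |0⟩_a = a |ψ⟩`. -/
def EncodesWithSubnorm {n b : ℕ} (U : OracleMatrix n b) (a : ℝ) (ψ : ℝ → ℝ) : Prop :=
  U ∈ Matrix.unitaryGroup (Fin n ⊕ Fin b → Bool) ℂ ∧
    ∀ x : Fin n → Bool,
      U (Sum.elim x (zeroBits (Fin b))) (zeroBits (Fin n ⊕ Fin b)) = ((a * encodedState n ψ x : ℝ) : ℂ)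

/-- Qubits available to a circuit: main register, ancilla register, and `w` workspace qubits. -/
abbrev Qubit (n b w : ℕ) : Type := (Fin n ⊕ Fin b) ⊕ Fin w

open Classical in
/-- The operator `V` acting on the qubits listed by `e`, tensored with the identity on all other
qubits of the register `Q`. -/
def actOn {S Q : Type} (e : S ↪ Q) (V : Matrix (S → Bool) (S → Bool) ℂ) :
    Matrix (Q → Bool) (Q → Bool) ℂ :=
  fun x y => if ∀ q, q ∉ range e → x q = y q then V (x ∘ e) (y ∘ e) else 0

/-- Gates: an arbitrary unitary on at most two qubits, or a use of the given unitary `U`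
or of its adjoint on the main and ancilla qubits. -/
inductive Gate (n b w : ℕ) : Type
  | elementary (m : ℕ) (hm : m ≤ 2) (e : Fin m ↪ Qubit n b w)
      (V : Matrix.unitaryGroup (Fin m → Bool) ℂ) : Gate n b w
  | call : Gate n b w
  | callAdjoint : Gate n b w

/-- The operator that a gate performs on the whole register when the given unitary is `U`. -/
def Gate.toMatrix {n b w : ℕ} (U : OracleMatrix n b) :
    Gate n b w → Matrix (Qubit n b w → Bool) (Qubit n b w → Bool) ℂ
  | .elementary _ _ e V => actOn e V.1
  | .call => actOn Function.Embedding.inl U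
  | .callAdjoint => actOn Function.Embedding.inl U.conjTranspose

/-- Whether a gate uses the given unitary. -/
def Gate.isCall {n b w : ℕ} : Gate n b w → Bool
  | .elementary _ _ _ _ => false
  | .call => true
  | .callAdjoint => true

/-- The state obtained from `|0 … 0⟩` by applying the gates of `c` from first to last. -/
def finalState {n b w : ℕ} (U : OracleMatrix n b) (c : List (Gate n b w)) :
    (Qubit n b w → Bool) → ℂ :=
  c.foldl (fun v g => (g.toMatrix U).mulVec v) (Pi.single (zeroBits (Qubit n b w)) 1)

/-- Quantum algorithms with classical control. `output r` stops and returns the real number `r`.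
`run w c next` prepares all qubits in state `0`, applies the circuit `c`, measures every qubit in
the computational basis, and goes on with `next z`, where `z` is the measurement outcome. -/
inductive Algorithm (n b : ℕ) : Type
  | output (r : ℝ) : Algorithm n b
  | run (w : ℕ) (c : List (Gate n b w)) (next : (Qubit n b w → Bool) → Algorithm n b) :
      Algorithm n b

namespace Algorithm

open Classical in
/-- The probability (Born rule) that the returned number lies in `T` when the given unitary
is `U`. -/
def prob {n b : ℕ} (U : OracleMatrix n b) (T : Set ℝ) : Algorithm n b → ℝ
  | .output r => if r ∈ T then 1 else 0
  | .run _ c next => ∑ z, ‖finalState U c z‖ ^ 2 * prob U T (next z)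

/-- Total number of uses of the given unitary and its adjoint, in the worst case over the
measurement outcomes. -/
def queryCost {n b : ℕ} : Algorithm n b → ℕ
  | .output _ => 0
  | .run _ c next => c.countP Gate.isCall + Finset.univ.sup fun z => queryCost (next z)

/-- Total number of gates (uses of the given unitary and its adjoint included), in the worst case
over the measurement outcomes. -/
def gateCost {n b : ℕ} : Algorithm n b → ℕ
  | .output _ => 0
  | .run _ c next => c.length + Finset.univ.sup fun z => gateCost (next z)

end Algorithm

end QEstimation

end

/-! The algorithm is amplitude estimation by interval search, with no phase estimation. An outcome
is good if the main register is below `X` and the ancilla and damping qubits are 0. The prepared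
state has weight sin² θ = (5a/13)² p on good outcomes, where p is the normalised sum of ψ(x_j)² over
j < X (`goodWeight_eq`). Increments of ψ² are at most Λ² ∫ (ψ² + 1) over the step, and ∫ ψ² = 1, so
p is within O(Λ²/2^n) of the integral (`abs_ratio_sub_integral_le`); bounding ψψ' pointwise would
only give Λ³.

Grover iterations turn the weight into sin²((2m+1)θ) (`sum_isGood_groverCircuit`). For an interval
known to contain θ, some m of order at most 1/width makes this probability differ by a constant
between the outer thirds (`exists_isTest`). Repeating the measurement, with a Chernoff bound
(`le_prob_sample`), discards an outer third without losing θ (`le_prob_search`). Since θ = O(a), an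
angle error of order aε suffices for an error ε in p (`abs_estimate_sub_le`), so a single run needs
O(1/(aε)) calls. The number of stages and the number of repetitions per stage each contribute one
logarithm, whence k = 2.

Both reflections in an iteration are made by one-bit automata that scan the qubits, then are
uncomputed (`evolve_phaseCircuit`); this costs O(n + b) gates. -/

noncomputable section

namespace QEstimation

/-! ### Discretisation of the integral -/

theorem gridPoint_mem {n j : ℕ} (hj : j ≤ 2 ^ n) : gridPoint n j ∈ Icc (-1 : ℝ) 1 := by
  have h2 : (0 : ℝ) < 2 ^ n := by positivity
  have hj' : (j : ℝ) ≤ 2 ^ n := by exact_mod_cast hj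
  have h1 : (j : ℝ) / 2 ^ n ≤ 1 := by rw [div_le_one h2]; exact hj'
  have h0 : 0 ≤ (j : ℝ) / 2 ^ n := by positivity
  unfold gridPoint
  rw [mul_div_assoc]
  constructor <;> linarith

theorem gridPoint_succ (n j : ℕ) : gridPoint n (j + 1) = gridPoint n j + 2 / 2 ^ n := by
  unfold gridPoint; push_cast; ring

theorem gridPoint_zero (n : ℕ) : gridPoint n 0 = -1 := by simp [gridPoint]

theorem gridPoint_last (n : ℕ) : gridPoint n (2 ^ n) = 1 := by
  unfold gridPoint; push_cast; field_simp; norm_num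

/-- A left Riemann sum is close to the integral when increments of `f` are controlled by those
of `H`. -/
theorem abs_leftSum_sub_integral_le {n : ℕ} {f H : ℝ → ℝ} (hf : ContinuousOn f (Icc (-1) 1))
    (hH : ∀ x ∈ Icc (-1 : ℝ) 1, ∀ y ∈ Icc (-1 : ℝ) 1, x ≤ y → |f y - f x| ≤ H y - H x)
    {K : ℕ} (hK : K ≤ 2 ^ n) :
    |2 / 2 ^ n * ∑ j ∈ Finset.range K, f (gridPoint n j) - ∫ x in (-1 : ℝ)..gridPoint n K, f x|
      ≤ 2 / 2 ^ n * (H (gridPoint n K) - H (-1)) := by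
  induction K with
  | zero => simp [gridPoint_zero]
  | succ K ih =>
    have ih := ih (by omega)
    have mK : gridPoint n K ∈ Icc (-1 : ℝ) 1 := gridPoint_mem (by omega)
    have mK' : gridPoint n (K + 1) ∈ Icc (-1 : ℝ) 1 := gridPoint_mem hK
    have hpos : (0 : ℝ) < 2 / 2 ^ n := by positivity
    have hs := gridPoint_succ n K
    have ii : ∀ a ∈ Icc (-1 : ℝ) 1, ∀ b ∈ Icc (-1 : ℝ) 1,
        IntervalIntegrable f MeasureTheory.volume a b := fun a ha b hb =>
      (hf.mono (uIcc_subset_Icc ha hb)).intervalIntegrable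
    have m1 : (-1 : ℝ) ∈ Icc (-1 : ℝ) 1 := by norm_num
    rw [Finset.sum_range_succ, ← intervalIntegral.integral_add_adjacent_intervals
      (ii _ m1 _ mK) (ii _ mK _ mK')]
    have hstep : |2 / 2 ^ n * f (gridPoint n K) - ∫ x in gridPoint n K..gridPoint n (K + 1), f x|
        ≤ 2 / 2 ^ n * (H (gridPoint n (K + 1)) - H (gridPoint n K)) := by
      have e : 2 / 2 ^ n * f (gridPoint n K) - ∫ x in gridPoint n K..gridPoint n (K + 1), f x
          = ∫ x in gridPoint n K..gridPoint n (K + 1), (f (gridPoint n K) - f x) := by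
        rw [intervalIntegral.integral_sub (by simp) (ii _ mK _ mK'),
          intervalIntegral.integral_const, hs]
        simp
      rw [e]
      have := intervalIntegral.norm_integral_le_of_norm_le_const
        (f := fun x => f (gridPoint n K) - f x) (a := gridPoint n K) (b := gridPoint n (K + 1))
        (C := H (gridPoint n (K + 1)) - H (gridPoint n K)) (by
          intro x hx
          rw [uIoc_of_le (by linarith)] at hx
          have mx : x ∈ Icc (-1 : ℝ) 1 := ⟨by linarith [mK.1, hx.1], by linarith [mK'.2, hx.2]⟩
          have h1 := hH _ mK _ mx hx.1.le
          have h2 := hH _ mx _ mK' hx.2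
          rw [Real.norm_eq_abs, abs_sub_comm]
          linarith [abs_nonneg (f (gridPoint n (K + 1)) - f x)])
      rw [Real.norm_eq_abs, hs, add_sub_cancel_left, abs_of_pos hpos, ← hs] at this
      linarith
    calc _ = |(2 / 2 ^ n * ∑ j ∈ Finset.range K, f (gridPoint n j)
              - ∫ x in (-1 : ℝ)..gridPoint n K, f x)
            + (2 / 2 ^ n * f (gridPoint n K)
              - ∫ x in gridPoint n K..gridPoint n (K + 1), f x)| := by congr 1; ring
      _ ≤ _ := abs_add_le _ _
      _ ≤ _ := by linarith

/-- Increments of `ψ ^ 2` are controlled by those of `Λ ^ 2 ∫ (ψ ^ 2 + 1)`. -/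
theorem abs_sq_sub_sq_le {ψ : ℝ → ℝ} {Λ : ℝ} (hψ : DifferentiableOn ℝ ψ (Icc (-1) 1))
    (hd : ∀ x ∈ Icc (-1 : ℝ) 1, |derivWithin ψ (Icc (-1) 1) x| ≤ Λ ^ 2)
    {x y : ℝ} (hx : x ∈ Icc (-1 : ℝ) 1) (hy : y ∈ Icc (-1 : ℝ) 1) (hxy : x ≤ y) :
    |ψ y ^ 2 - ψ x ^ 2| ≤ (Λ ^ 2 * ∫ t in (-1 : ℝ)..y, (ψ t ^ 2 + 1))
      - Λ ^ 2 * ∫ t in (-1 : ℝ)..x, (ψ t ^ 2 + 1) := by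
  have hc := hψ.continuousOn
  have hg : ContinuousOn (fun t => ψ t ^ 2 + 1) (Icc (-1) 1) := by fun_prop
  have hI : ContinuousOn (fun y => ∫ t in (-1 : ℝ)..y, (ψ t ^ 2 + 1)) (Icc (-1) 1) := by
    have := intervalIntegral.continuousOn_primitive_interval (μ := MeasureTheory.volume)
      (a := -1) (b := 1) (f := fun t => ψ t ^ 2 + 1)
      (by rw [uIcc_of_le (by norm_num)]; exact hg.integrableOn_Icc)
    rwa [uIcc_of_le (by norm_num)] at this
  have hdI : ∀ z ∈ Ioo (-1 : ℝ) 1,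
      HasDerivAt (fun y => ∫ t in (-1 : ℝ)..y, (ψ t ^ 2 + 1)) (ψ z ^ 2 + 1) z := by
    intro z hz
    have hn : Icc (-1 : ℝ) 1 ∈ nhds z := Icc_mem_nhds hz.1 hz.2
    refine intervalIntegral.integral_hasDerivAt_right ?_ ?_ (hg.continuousAt hn)
    · exact (hg.mono (uIcc_subset_Icc (by norm_num) ⟨hz.1.le, hz.2.le⟩)).intervalIntegrable
    · exact hg.stronglyMeasurableAtFilter_nhdsWithin measurableSet_Icc z |>.filter_mono
        (le_of_eq (nhdsWithin_eq_nhds.2 hn).symm)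
  have hdψ : ∀ z ∈ Ioo (-1 : ℝ) 1, ∃ d, HasDerivAt ψ d z ∧ |d| ≤ Λ ^ 2 := by
    intro z hz
    have hn : Icc (-1 : ℝ) 1 ∈ nhds z := Icc_mem_nhds hz.1 hz.2
    have hz' : z ∈ Icc (-1 : ℝ) 1 := ⟨hz.1.le, hz.2.le⟩
    exact ⟨_, (hψ z hz').hasDerivWithinAt.hasDerivAt hn, hd z hz'⟩
  -- The signs σ = 1 and σ = -1 give the two sides of the absolute value.
  have mono : ∀ σ : ℝ, |σ| = 1 → MonotoneOn (fun y => (Λ ^ 2 * ∫ t in (-1 : ℝ)..y, (ψ t ^ 2 + 1))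
      - σ * ψ y ^ 2) (Icc (-1) 1) := by
    intro σ hσ
    refine monotoneOn_of_deriv_nonneg (convex_Icc _ _) (by fun_prop) ?_ ?_
    · rw [interior_Icc]
      intro z hz
      obtain ⟨d, h1, -⟩ := hdψ z hz
      exact (((hdI z hz).const_mul _).sub ((h1.pow 2).const_mul σ)).differentiableAt
        |>.differentiableWithinAt
    · rw [interior_Icc]
      intro z hz
      obtain ⟨d, h1, h2⟩ := hdψ z hz
      have hder : HasDerivAt (fun y => (Λ ^ 2 * ∫ t in (-1 : ℝ)..y, (ψ t ^ 2 + 1)) - σ * ψ y ^ 2)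
          (Λ ^ 2 * (ψ z ^ 2 + 1) - σ * ((2 : ℕ) * ψ z ^ (2 - 1) * d)) z :=
        ((hdI z hz).const_mul _).sub ((h1.pow 2).const_mul σ)
      rw [hder.deriv]
      have h3 : σ * ((2 : ℕ) * ψ z ^ (2 - 1) * d) ≤ 2 * |ψ z| * Λ ^ 2 := by
        refine (le_abs_self _).trans ?_
        rw [abs_mul, hσ, abs_mul, abs_mul]
        norm_num
        gcongr
      -- 2|ψ| ≤ ψ² + 1 replaces the pointwise size of ψ by its mass, keeping the power of Λ at two.
      nlinarith [mul_nonneg (sq_nonneg Λ) (sq_nonneg (|ψ z| - 1)), sq_abs (ψ z)]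
  have h1 := mono 1 (by norm_num) hx hy hxy
  have h2 := mono (-1) (by norm_num) hx hy hxy
  simp only at h1 h2
  rw [abs_le]
  constructor <;> linarith

/-- The normalised left Riemann sum of `ψ ^ 2` approximates its integral. -/
theorem abs_ratio_sub_integral_le {n X : ℕ} {ψ : ℝ → ℝ} {Λ : ℝ} (hX : X ≤ 2 ^ n)
    (hψ : DifferentiableOn ℝ ψ (Icc (-1) 1))
    (hd : ∀ x ∈ Icc (-1 : ℝ) 1, |derivWithin ψ (Icc (-1) 1) x| ≤ Λ ^ 2)
    (hint : (∫ x in (-1 : ℝ)..1, ψ x ^ 2) = 1) (hN : 0 < gridNormSq n ψ) :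
    |(∑ j ∈ Finset.range X, ψ (gridPoint n j) ^ 2) / gridNormSq n ψ
      - ∫ x in (-1 : ℝ)..gridPoint n X, ψ x ^ 2| ≤ 12 * Λ ^ 2 / 2 ^ n := by
  have hc := hψ.continuousOn
  have hf : ContinuousOn (fun t => ψ t ^ 2) (Icc (-1) 1) := by fun_prop
  have hH : ∀ K ≤ 2 ^ n, |2 / 2 ^ n * ∑ j ∈ Finset.range K, ψ (gridPoint n j) ^ 2
      - ∫ x in (-1 : ℝ)..gridPoint n K, ψ x ^ 2| ≤ 6 * Λ ^ 2 / 2 ^ n := by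
    intro K hK
    have h := abs_leftSum_sub_integral_le (f := fun t => ψ t ^ 2)
      (H := fun y => Λ ^ 2 * ∫ t in (-1 : ℝ)..y, (ψ t ^ 2 + 1)) hf
      (fun x hx y hy hxy => abs_sq_sub_sq_le hψ hd hx hy hxy) hK
    refine h.trans ?_
    have mK := gridPoint_mem (n := n) hK
    have hb : (∫ t in (-1 : ℝ)..gridPoint n K, (ψ t ^ 2 + 1)) ≤ 3 := by
      have e : (∫ t in (-1 : ℝ)..1, (ψ t ^ 2 + 1)) = 3 := by
        rw [intervalIntegral.integral_add, hint]
        · norm_num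
        · exact (hf.mono (uIcc_subset_Icc (by norm_num) (by norm_num))).intervalIntegrable
        · simp
      rw [← e]
      refine intervalIntegral.integral_mono_interval le_rfl mK.1 mK.2 ?_ ?_
      · exact Filter.Eventually.of_forall fun x => by positivity
      · refine ContinuousOn.intervalIntegrable ?_
        rw [uIcc_of_le (by norm_num)]
        fun_prop
    simp only [intervalIntegral.integral_same, mul_zero, sub_zero]
    calc _ ≤ 2 / 2 ^ n * (Λ ^ 2 * 3) := by gcongr
      _ = _ := by ring
  have h1 := hH X hX
  have h2 := hH (2 ^ n) le_rfl
  rw [gridPoint_last, hint] at h2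
  change |2 / 2 ^ n * gridNormSq n ψ - 1| ≤ _ at h2
  set S := ∑ j ∈ Finset.range X, ψ (gridPoint n j) ^ 2 with hS
  set N := gridNormSq n ψ with hNdef
  set I := ∫ x in (-1 : ℝ)..gridPoint n X, ψ x ^ 2
  have hS0 : 0 ≤ S := Finset.sum_nonneg fun _ _ => sq_nonneg _
  have hSN : S ≤ N := by
    rw [hS, hNdef, gridNormSq]
    exact Finset.sum_le_sum_of_subset_of_nonneg
      (by simpa using hX) fun _ _ _ => sq_nonneg _
  have hp : |S / N| ≤ 1 := by
    rw [abs_of_nonneg (by positivity), div_le_one hN]; exact hSN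
  -- The errors of the partial and of the full Riemann sum enter with coefficients 1 and S/N ≤ 1,
  -- hence 6 + 6 = 12.
  have e : S / N - I = (2 / 2 ^ n * S - I) - S / N * (2 / 2 ^ n * N - 1) := by
    field_simp; ring
  rw [e]
  refine (abs_sub _ _).trans ?_
  rw [abs_mul]
  have : |S / N| * |2 / 2 ^ n * N - 1| ≤ 1 * (6 * Λ ^ 2 / 2 ^ n) := by gcongr
  calc _ ≤ 6 * Λ ^ 2 / 2 ^ n + 1 * (6 * Λ ^ 2 / 2 ^ n) := add_le_add h1 this
    _ = _ := by ring

/-! ### Choice of the number of Grover iterations for an interval of angles -/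

/-- Some odd multiple of `x` stays away from all integer multiples of `π`. -/
theorem exists_odd_mul_mem {x w : ℝ} (hw : 0 < w) (hwx : w ≤ x) (hx : x ≤ 1) (hw2 : w ≤ 1 / 2) :
    ∃ m j : ℕ, 1 / 30 ≤ (2 * m + 1) * w ∧ (2 * m + 1) * w ≤ 1 / 2 ∧
      j * Real.pi + 2 / 3 * ((2 * m + 1) * w) ≤ (2 * m + 1) * x ∧
      (2 * m + 1) * x ≤ (j + 1) * Real.pi - 2 / 3 * ((2 * m + 1) * w) := by
  have hpi := Real.pi_gt_three
  have hx0 : 0 < x := hw.trans_le hwx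
  -- The largest m₀ with (2m₀+1)w ≤ 1/2. As 2m₀+3 ≤ 3(2m₀+1), the product is also at least 1/6.
  obtain ⟨m₀, h1, h2⟩ : ∃ m₀ : ℕ, (2 * m₀ + 1) * w ≤ 1 / 2 ∧ 1 / 2 < (2 * m₀ + 3) * w := by
    have hq : 0 ≤ ((1 / 2) / w - 1) / 2 := by
      have : 1 ≤ (1 / 2) / w := by rw [le_div_iff₀ hw]; linarith
      linarith
    refine ⟨⌊((1 / 2) / w - 1) / 2⌋₊, ?_, ?_⟩
    · have := Nat.floor_le hq
      have h : 2 * (⌊((1 / 2) / w - 1) / 2⌋₊ : ℝ) + 1 ≤ (1 / 2) / w := by linarith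
      rwa [le_div_iff₀ hw] at h
    · have := Nat.lt_floor_add_one (((1 / 2) / w - 1) / 2)
      have h : (1 / 2) / w < 2 * (⌊((1 / 2) / w - 1) / 2⌋₊ : ℝ) + 3 := by linarith
      rwa [div_lt_iff₀ hw] at h
  have hm₀ : (0 : ℝ) ≤ m₀ := m₀.cast_nonneg
  have h6 : 1 / 6 ≤ (2 * m₀ + 1) * w := by nlinarith
  have hwx0 : (2 * m₀ + 1) * w ≤ (2 * m₀ + 1) * x := by gcongr
  by_cases hc : (2 * m₀ + 1) * x ≤ Real.pi - 1 / 2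
  · exact ⟨m₀, 0, by linarith, h1, by push_cast; linarith, by push_cast; linarith⟩
  push Not at hc
  obtain ⟨j, hj1, hj2⟩ : ∃ j : ℕ, j * Real.pi ≤ (2 * m₀ + 1) * x + 1 / 2 ∧
      (2 * m₀ + 1) * x + 1 / 2 < (j + 1) * Real.pi := by
    refine ⟨⌊((2 * m₀ + 1) * x + 1 / 2) / Real.pi⌋₊, ?_, ?_⟩
    · rw [← le_div_iff₀ Real.pi_pos]
      exact Nat.floor_le (by positivity)
    · rw [← div_lt_iff₀ Real.pi_pos]
      exact Nat.lt_floor_add_one _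
  by_cases hg : j * Real.pi + 1 / 2 ≤ (2 * m₀ + 1) * x
  · exact ⟨m₀, j, by linarith, h1, by linarith, by linarith⟩
  push Not at hg
  obtain ⟨j, rfl⟩ : ∃ i, j = i + 1 := by
    refine Nat.exists_eq_succ_of_ne_zero ?_
    rintro rfl
    push_cast at hj2; linarith
  push_cast at hj1 hj2 hg
  -- Here (2m₀+1)x is within 1/2 of (j+1)π. Dropping iterations lowers it in steps 2x ≤ 2, shorter
  -- than the safe window of length π - 1 below that multiple, so the least sufficient i lands
  -- inside the window.
  obtain ⟨i, hi1, hi2⟩ : ∃ i : ℕ, (2 * m₀ + 1) * x - (j + 1) * Real.pi + 1 / 2 ≤ 2 * x * i ∧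
      2 * x * i < (2 * m₀ + 1) * x - (j + 1) * Real.pi + 1 / 2 + 2 * x := by
    have hnn : 0 ≤ ((2 * m₀ + 1) * x - (j + 1) * Real.pi + 1 / 2) / (2 * x) := by
      apply div_nonneg <;> linarith
    refine ⟨⌈((2 * m₀ + 1) * x - (j + 1) * Real.pi + 1 / 2) / (2 * x)⌉₊, ?_, ?_⟩
    · have := Nat.le_ceil (((2 * m₀ + 1) * x - (j + 1) * Real.pi + 1 / 2) / (2 * x))
      rwa [div_le_iff₀' (by positivity)] at this
    · have := Nat.ceil_lt_add_one hnn
      rw [← sub_lt_iff_lt_add, lt_div_iff₀ (by positivity)] at this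
      linarith
  have hjpi : 0 ≤ j * Real.pi := by positivity
  have hi : i ≤ m₀ := by
    by_contra hlt
    have : (m₀ : ℝ) + 1 ≤ i := by exact_mod_cast Nat.lt_of_not_le hlt
    nlinarith
  obtain ⟨m, rfl⟩ : ∃ m, m₀ = m + i := ⟨m₀ - i, by omega⟩
  push_cast at *
  have hm : (0 : ℝ) ≤ m := m.cast_nonneg
  have hi0 : (0 : ℝ) ≤ i := i.cast_nonneg
  have hmw : (2 * m + 1) * w ≤ 1 / 2 := by nlinarith
  refine ⟨m, j, ?_, hmw, by nlinarith, by nlinarith⟩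
  -- Dropping i iterations loses at most a factor 5, which turns 1/6 into 1/30.
  have h5 : 2 * (m + i : ℝ) + 1 ≤ 5 * (2 * m + 1) := by
    by_contra hlt
    push Not at hlt
    nlinarith
  have : (2 * (m + i : ℝ) + 1) * w ≤ 5 * (2 * m + 1) * w := by gcongr
  linarith

theorem sin_sq_sub_sin_sq (x y : ℝ) :
    Real.sin x ^ 2 - Real.sin y ^ 2 = Real.sin (x + y) * Real.sin (x - y) := by
  rw [Real.sin_add, Real.sin_sub]
  nlinarith [Real.sin_sq_add_cos_sq x, Real.sin_sq_add_cos_sq y]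

theorem half_le_sin {x : ℝ} (h0 : 0 ≤ x) (h1 : x ≤ 1) : x / 2 ≤ Real.sin x := by
  have h := Real.mul_le_sin h0 (by linarith [Real.pi_gt_three])
  have : 1 / 2 ≤ 2 / Real.pi := by
    rw [div_le_div_iff₀ (by norm_num) Real.pi_pos]; linarith [Real.pi_le_four]
  nlinarith

/-- After `m` Grover iterations at angle `θ` the success probability is `sin² ((2 m + 1) θ)`. For
angles in `[l, l + w]`, comparing it with the threshold `τ`, in the direction given by the sign `σ`,
tells the left third from the right third with a definite margin. -/
structure IsTest (l w : ℝ) (m : ℕ) (τ σ : ℝ) : Prop where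
  sign : σ = 1 ∨ σ = -1
  size : (2 * m + 1) * w ≤ 1 / 2
  left : ∀ θ, l ≤ θ → θ ≤ l + w / 3 → σ * (Real.sin ((2 * m + 1) * θ) ^ 2 - τ) ≤ -(1 / 40000)
  right : ∀ θ, l + 2 * w / 3 ≤ θ → θ ≤ l + w →
    1 / 40000 ≤ σ * (Real.sin ((2 * m + 1) * θ) ^ 2 - τ)

/-- With K = 2m+1, the difference of sin²(Kθ) at two angles is the product of the sines of K times
their sum and K times their difference. K(2l+w) is kept away from the multiples of π, so the first
factor has the constant sign (-1)^j on the sums that occur. This orders the outer thirds; τ is the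
mean of the values at the two inner division points. -/
theorem exists_isTest {l w : ℝ} (hl : 0 ≤ l) (hw : 0 < w) (hu : l + w ≤ 1 / 2) :
    ∃ m τ σ, IsTest l w m τ σ := by
  obtain ⟨m, j, h1, h2, h3, h4⟩ := exists_odd_mul_mem (x := 2 * l + w) hw (by linarith)
    (by linarith) (by linarith)
  set K : ℝ := 2 * m + 1 with hK
  have hK0 : 0 < K := by positivity
  have hpi := Real.pi_gt_three
  have hshift : ∀ y, Real.sin y = (-1) ^ j * Real.sin (y - j * Real.pi) := by
    intro y
    rw [Real.sin_sub_nat_mul_pi, ← mul_assoc, ← mul_pow]; simp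
  have hσ : ((-1 : ℝ) ^ j) = 1 ∨ ((-1 : ℝ) ^ j) = -1 := neg_one_pow_eq_or ℝ j
  have hσ2 : ((-1 : ℝ) ^ j) * (-1) ^ j = 1 := by rw [← mul_pow]; simp
  -- An angle in an outer third plus the inner end of that third differs from 2l + w by at most
  -- 2w/3; this is the margin built into `exists_odd_mul_mem`.
  have hnn : ∀ y, 2 * l + w / 3 ≤ y → y ≤ 2 * l + w + 2 * w / 3 →
      0 ≤ (-1) ^ j * Real.sin (K * y) := by
    intro y hy1 hy2
    rw [hshift (K * y), ← mul_assoc, hσ2, one_mul]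
    have e1 : K * (2 * l + w / 3) ≤ K * y := by gcongr
    have e2 : K * y ≤ K * (2 * l + w + 2 * w / 3) := by gcongr
    apply Real.sin_nonneg_of_nonneg_of_le_pi <;> nlinarith
  have hmid : 1 / 90 ≤ (-1) ^ j * Real.sin (K * (2 * l + w)) := by
    rw [hshift (K * _), ← mul_assoc, hσ2, one_mul]
    set y := K * (2 * l + w) - j * Real.pi
    have y1 : 1 / 45 ≤ y := by simp only [y]; linarith
    have y2 : y ≤ Real.pi - 1 / 45 := by simp only [y]; linarith
    by_cases hy : y ≤ 1
    · linarith [half_le_sin (by linarith) hy]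
    · rcases le_total y (Real.pi / 2) with hh | hh
      · have := Real.mul_le_sin (by linarith : 0 ≤ y) hh
        have h2 : 1 / 2 ≤ 2 / Real.pi := by
          rw [div_le_div_iff₀ (by norm_num) Real.pi_pos]; linarith [Real.pi_le_four]
        nlinarith
      · rw [← Real.sin_pi_sub]
        have := Real.mul_le_sin (by linarith : 0 ≤ Real.pi - y) (by linarith)
        have h2 : 1 / 2 ≤ 2 / Real.pi := by
          rw [div_le_div_iff₀ (by norm_num) Real.pi_pos]; linarith [Real.pi_le_four]
        nlinarith
  have hthird : 1 / 180 ≤ Real.sin (K * (w / 3)) := by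
    linarith [half_le_sin (x := K * (w / 3)) (by positivity) (by nlinarith)]
  have hsmall : ∀ z, 0 ≤ z → z ≤ w / 3 → 0 ≤ Real.sin (K * z) := by
    intro z hz1 hz2
    have : K * z ≤ K * (w / 3) := by gcongr
    exact Real.sin_nonneg_of_nonneg_of_le_pi (by positivity) (by linarith)
  -- (1/90)(1/180) = 1/16200 exceeds 1/20000, and half of the latter is the margin on each side of
  -- τ.
  have hgap : 1 / 20000 ≤ (-1) ^ j * (Real.sin (K * (l + 2 * w / 3)) ^ 2
      - Real.sin (K * (l + w / 3)) ^ 2) := by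
    rw [sin_sq_sub_sin_sq, ← mul_add, ← mul_sub, ← mul_assoc]
    rw [show l + 2 * w / 3 + (l + w / 3) = 2 * l + w by ring,
      show l + 2 * w / 3 - (l + w / 3) = w / 3 by ring]
    have := mul_le_mul hmid hthird (by norm_num) (le_trans (by norm_num) hmid)
    linarith
  refine ⟨m, (Real.sin (K * (l + 2 * w / 3)) ^ 2 + Real.sin (K * (l + w / 3)) ^ 2) / 2,
    (-1) ^ j, hσ, h2, ?_, ?_⟩
  · intro θ ht1 ht2
    have := mul_nonneg (hnn ((l + w / 3) + θ) (by linarith) (by linarith))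
      (hsmall ((l + w / 3) - θ) (by linarith) (by linarith))
    rw [mul_assoc, mul_add, mul_sub, ← sin_sq_sub_sin_sq] at this
    linarith
  · intro θ ht1 ht2
    have := mul_nonneg (hnn (θ + (l + 2 * w / 3)) (by linarith) (by linarith))
      (hsmall (θ - (l + 2 * w / 3)) (by linarith) (by linarith))
    rw [mul_assoc, mul_add, mul_sub, ← sin_sq_sub_sin_sq] at this
    linarith

section Circuits

/-! ### Operators acting on some of the qubits -/

section ActOn

variable {S Q : Type}

theorem extend_comp (e : S ↪ Q) (s : S → Bool) (z : Q → Bool) :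
    Function.extend e s z ∘ e = s := by
  funext t; simp [e.injective.extend_apply]

theorem extend_extend (e : S ↪ Q) (s s' : S → Bool) (z : Q → Bool) :
    Function.extend e s' (Function.extend e s z) = Function.extend e s' z := by
  funext q
  by_cases h : ∃ t, e t = q
  · obtain ⟨t, rfl⟩ := h; simp [e.injective.extend_apply]
  · rw [Function.extend_apply' _ _ _ h, Function.extend_apply' _ _ _ h,
      Function.extend_apply' _ _ _ h]

theorem extend_comp_self (e : S ↪ Q) (z : Q → Bool) : Function.extend e (z ∘ e) z = z := by
  funext q
  by_cases h : ∃ t, e t = q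
  · obtain ⟨t, rfl⟩ := h; simp [e.injective.extend_apply]
  · rw [Function.extend_apply' _ _ _ h]

theorem extend_apply_not_mem (e : S ↪ Q) (s : S → Bool) (z : Q → Bool) {q : Q}
    (hq : q ∉ range e) : Function.extend e s z q = z q :=
  Function.extend_apply' _ _ _ hq

theorem actOn_conjTranspose (e : S ↪ Q) (V : Matrix (S → Bool) (S → Bool) ℂ) :
    (actOn e V).conjTranspose = actOn e V.conjTranspose := by
  ext x y
  simp only [Matrix.conjTranspose_apply, actOn]
  by_cases h : ∀ q, q ∉ range e → x q = y q
  · rw [if_pos h, if_pos (fun q hq => (h q hq).symm)]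
  · rw [if_neg h, if_neg (fun h' => h fun q hq => (h' q hq).symm), star_zero]

variable [Fintype S] [Fintype Q] [DecidableEq S] [DecidableEq Q]

/-- Only basis states agreeing with z off the range of e contribute, and `Function.extend`
parametrises them by the bits on S. -/
theorem actOn_mulVec (e : S ↪ Q) (V : Matrix (S → Bool) (S → Bool) ℂ) (v : (Q → Bool) → ℂ)
    (z : Q → Bool) :
    (actOn e V).mulVec v z = ∑ s, V (z ∘ e) s * v (Function.extend e s z) := by
  symm
  refine Fintype.sum_of_injective (fun s => Function.extend e s z) ?_ _ _ ?_ ?_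
  · intro s s' h
    have := congrArg (fun f => f ∘ e) h
    simpa only [extend_comp] using this
  · intro y hy
    simp only [actOn]
    rw [if_neg, zero_mul]
    intro h
    refine hy ⟨y ∘ e, ?_⟩
    funext q
    by_cases hq : ∃ t, e t = q
    · obtain ⟨t, rfl⟩ := hq; simp [e.injective.extend_apply]
    · simp only [Function.extend_apply' _ _ _ hq]
      exact h q hq
  · intro s
    simp only [actOn]
    rw [if_pos (fun q hq => (extend_apply_not_mem e s z hq).symm), extend_comp]

theorem actOn_mul (e : S ↪ Q) (V W : Matrix (S → Bool) (S → Bool) ℂ) :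
    actOn e V * actOn e W = actOn e (V * W) := by
  apply Matrix.mulVec_injective
  funext v z
  rw [← Matrix.mulVec_mulVec, actOn_mulVec, actOn_mulVec]
  simp only [actOn_mulVec, extend_comp, extend_extend, Matrix.mul_apply, Finset.mul_sum,
    Finset.sum_mul, mul_assoc]
  rw [Finset.sum_comm]

theorem actOn_one (e : S ↪ Q) : actOn e (1 : Matrix (S → Bool) (S → Bool) ℂ) = 1 := by
  apply Matrix.mulVec_injective
  funext v z
  rw [actOn_mulVec, Matrix.one_mulVec, Finset.sum_eq_single (z ∘ e)]
  · simp [extend_comp_self]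
  · intro s _ hs; simp [Matrix.one_apply_ne hs.symm]
  · simp

theorem actOn_conjTranspose_mul_self (e : S ↪ Q) {V : Matrix (S → Bool) (S → Bool) ℂ}
    (hV : V ∈ Matrix.unitaryGroup (S → Bool) ℂ) :
    (actOn e V).conjTranspose * actOn e V = 1 := by
  rw [actOn_conjTranspose, actOn_mul, ← Matrix.star_eq_conjTranspose,
    Matrix.mem_unitaryGroup_iff'.1 hV, actOn_one]

/-- The vectors supported on basis states in which the qubit `q` is `0`. -/
def zeroAt (q : Q) : Set ((Q → Bool) → ℂ) := {v | ∀ z, z q = true → v z = 0}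

theorem actOn_mulVec_mem_zeroAt (e : S ↪ Q) (V : Matrix (S → Bool) (S → Bool) ℂ)
    {v : (Q → Bool) → ℂ} {q : Q} (hq : q ∉ range e) (hv : v ∈ zeroAt q) :
    (actOn e V).mulVec v ∈ zeroAt q := by
  intro z hz
  rw [actOn_mulVec]
  refine Finset.sum_eq_zero fun s _ => ?_
  rw [hv _ ((extend_apply_not_mem e s z hq).trans hz), mul_zero]

end ActOn

/-! ### Circuits as linear maps -/

variable {n b w : ℕ}

/-- The state space of a register. -/
abbrev StateSpace (n b w : ℕ) : Type := (Qubit n b w → Bool) → ℂ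

/-- The inverse gate. -/
def Gate.adj : Gate n b w → Gate n b w
  | .elementary m hm e V => .elementary m hm e V⁻¹
  | .call => .callAdjoint
  | .callAdjoint => .call

theorem Gate.toMatrix_adj (U : OracleMatrix n b) (g : Gate n b w) :
    g.adj.toMatrix U = (g.toMatrix U).conjTranspose := by
  cases g with
  | elementary m hm e V => exact (actOn_conjTranspose e V.1).symm
  | call => exact (actOn_conjTranspose _ U).symm
  | callAdjoint =>
    simp only [Gate.adj, Gate.toMatrix, actOn_conjTranspose, Matrix.conjTranspose_conjTranspose]

theorem Gate.conjTranspose_mul_self {U : OracleMatrix n b}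
    (hU : U ∈ Matrix.unitaryGroup (Fin n ⊕ Fin b → Bool) ℂ) (g : Gate n b w) :
    (g.toMatrix U).conjTranspose * g.toMatrix U = 1 := by
  cases g with
  | elementary m hm e V => exact actOn_conjTranspose_mul_self e V.2
  | call => exact actOn_conjTranspose_mul_self _ hU
  | callAdjoint => exact actOn_conjTranspose_mul_self _ (Unitary.star_mem hU)

theorem Gate.adj_adj (g : Gate n b w) : g.adj.adj = g := by
  cases g <;> simp [Gate.adj]

theorem Gate.isCall_adj (g : Gate n b w) : g.adj.isCall = g.isCall := by
  cases g <;> rfl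

/-- The linear map performed by a circuit. -/
def evolve (U : OracleMatrix n b) : List (Gate n b w) → StateSpace n b w →ₗ[ℂ] StateSpace n b w
  | [] => LinearMap.id
  | g :: c => evolve U c ∘ₗ (g.toMatrix U).mulVecLin

theorem evolve_cons (U : OracleMatrix n b) (g : Gate n b w) (c : List (Gate n b w))
    (v : StateSpace n b w) : evolve U (g :: c) v = evolve U c ((g.toMatrix U).mulVec v) := rfl

theorem evolve_append (U : OracleMatrix n b) (c d : List (Gate n b w)) (v : StateSpace n b w) :
    evolve U (c ++ d) v = evolve U d (evolve U c v) := by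
  induction c generalizing v with
  | nil => rfl
  | cons g c ih => exact ih _

/-- The basis vector of a basis state. -/
def basisState (z : Qubit n b w → Bool) : StateSpace n b w := Pi.single z 1

theorem finalState_eq (U : OracleMatrix n b) (c : List (Gate n b w)) :
    finalState U c = evolve U c (basisState (zeroBits _)) := by
  unfold finalState basisState
  generalize (Pi.single (zeroBits (Qubit n b w)) 1 : StateSpace n b w) = v
  induction c generalizing v with
  | nil => rfl
  | cons g c ih => exact ih _

/-- The inverse circuit. -/
def invCircuit (c : List (Gate n b w)) : List (Gate n b w) := (c.map Gate.adj).reverse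

theorem invCircuit_invCircuit (c : List (Gate n b w)) : invCircuit (invCircuit c) = c := by
  simp [invCircuit, List.map_reverse, Function.comp_def, Gate.adj_adj]

/-- The standard Hermitian product. -/
def herm (u v : StateSpace n b w) : ℂ := star u ⬝ᵥ v

theorem herm_mulVec (u v : StateSpace n b w) (M : Matrix (Qubit n b w → Bool) _ ℂ) :
    herm (M.mulVec u) v = herm u (M.conjTranspose.mulVec v) := by
  simp only [herm, Matrix.star_mulVec, Matrix.dotProduct_mulVec]

/-- Inverse gates are conjugate transposes by construction, so no unitarity of U is involved here;
it is needed only for cancellation. -/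
theorem herm_evolve (U : OracleMatrix n b) (c : List (Gate n b w)) (u v : StateSpace n b w) :
    herm (evolve U c u) v = herm u (evolve U (invCircuit c) v) := by
  induction c generalizing u with
  | nil => rfl
  | cons g c ih =>
    rw [evolve_cons, ih, herm_mulVec, ← Gate.toMatrix_adj]
    simp [invCircuit, evolve_append, evolve]

theorem evolve_invCircuit {U : OracleMatrix n b}
    (hU : U ∈ Matrix.unitaryGroup (Fin n ⊕ Fin b → Bool) ℂ) (c : List (Gate n b w))
    (v : StateSpace n b w) : evolve U (invCircuit c) (evolve U c v) = v := by
  induction c generalizing v with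
  | nil => rfl
  | cons g c ih =>
    have e : invCircuit (g :: c) = invCircuit c ++ [g.adj] := by simp [invCircuit]
    rw [e, evolve_append, evolve_cons U g c, ih, evolve_cons, Gate.toMatrix_adj, Matrix.mulVec_mulVec,
      Gate.conjTranspose_mul_self hU, Matrix.one_mulVec]
    rfl

theorem evolve_evolve_invCircuit {U : OracleMatrix n b}
    (hU : U ∈ Matrix.unitaryGroup (Fin n ⊕ Fin b → Bool) ℂ) (c : List (Gate n b w))
    (v : StateSpace n b w) : evolve U c (evolve U (invCircuit c) v) = v := by
  simpa [invCircuit_invCircuit] using evolve_invCircuit hU (invCircuit c) v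

theorem herm_evolve_evolve {U : OracleMatrix n b}
    (hU : U ∈ Matrix.unitaryGroup (Fin n ⊕ Fin b → Bool) ℂ) (c : List (Gate n b w))
    (u v : StateSpace n b w) : herm (evolve U c u) (evolve U c v) = herm u v := by
  rw [herm_evolve, evolve_invCircuit hU]

theorem herm_self (v : StateSpace n b w) : herm v v = ((∑ z, ‖v z‖ ^ 2 : ℝ) : ℂ) := by
  simp only [herm, dotProduct, Pi.star_apply, Complex.ofReal_sum]
  refine Finset.sum_congr rfl fun z _ => ?_
  rw [mul_comm, Complex.star_def, Complex.mul_conj, Complex.normSq_eq_norm_sq]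

theorem herm_basisState_left (z : Qubit n b w → Bool) (v : StateSpace n b w) :
    herm (basisState z) v = v z := by
  simp [herm, basisState, dotProduct, Pi.single_apply, apply_ite]

theorem sum_norm_sq_finalState {U : OracleMatrix n b}
    (hU : U ∈ Matrix.unitaryGroup (Fin n ⊕ Fin b → Bool) ℂ) (c : List (Gate n b w)) :
    ∑ z, ‖finalState U c z‖ ^ 2 = 1 := by
  have h := herm_evolve_evolve hU c (basisState (zeroBits _)) (basisState (zeroBits _))
  rw [← finalState_eq, herm_self, herm_basisState_left] at h
  have : basisState (zeroBits (Qubit n b w)) (zeroBits (Qubit n b w)) = 1 := by simp [basisState]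
  rw [this] at h
  exact_mod_cast h

theorem countP_invCircuit (c : List (Gate n b w)) :
    (invCircuit c).countP Gate.isCall = c.countP Gate.isCall := by
  simp [invCircuit, List.countP_map, Function.comp_def, Gate.isCall_adj]

theorem length_invCircuit (c : List (Gate n b w)) : (invCircuit c).length = c.length := by
  simp [invCircuit]

end Circuits

section Automata

variable {n b w : ℕ}

/-! ### Controlled gates on two qubits -/

/-- The pair of qubits `c`, `t` as an embedding. -/
def pairEmb {Q : Type} (c t : Q) (h : c ≠ t) : Fin 2 ↪ Q :=
  ⟨![c, t], by
    intro i j hij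
    fin_cases i <;> fin_cases j <;> simp_all [eq_comm]⟩

theorem range_pairEmb {Q : Type} {c t : Q} (h : c ≠ t) : range (pairEmb c t h) = {c, t} := by
  ext q
  simp only [mem_range, Fin.exists_fin_two, mem_insert_iff, mem_singleton_iff]
  change (c = q ∨ t = q) ↔ _
  rw [eq_comm, eq_comm (a := t)]

/-- The two-qubit operator that applies `W 0` or `W 1` to the second qubit, according to the value
of the first. -/
def ctlMatrix (W : Bool → Matrix Bool Bool ℂ) : Matrix (Fin 2 → Bool) (Fin 2 → Bool) ℂ :=
  fun x y => if x 0 = y 0 then W (x 0) (x 1) (y 1) else 0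

theorem ctlMatrix_mem {W : Bool → Matrix Bool Bool ℂ}
    (hW : ∀ c, W c ∈ Matrix.unitaryGroup Bool ℂ) :
    ctlMatrix W ∈ Matrix.unitaryGroup (Fin 2 → Bool) ℂ := by
  rw [Matrix.mem_unitaryGroup_iff]
  ext x y
  have h := fun c => Matrix.mem_unitaryGroup_iff.1 (hW c)
  rw [Matrix.mul_apply, ← (finTwoArrowEquiv Bool).symm.sum_comp, Fintype.sum_prod_type]
  have h' := fun c i j => congrFun (congrFun (h c) i) j
  simp only [Matrix.mul_apply, Matrix.star_apply, Fintype.sum_bool] at h'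
  have e : x = y ↔ x 0 = y 0 ∧ x 1 = y 1 := by
    rw [funext_iff, Fin.forall_fin_two]
  simp only [Matrix.star_apply, ctlMatrix, Fintype.sum_bool, finTwoArrowEquiv_symm_apply,
    Matrix.cons_val_zero, Matrix.cons_val_one, Matrix.one_apply, e]
  have h1 := h' (x 0) (x 1) (y 1)
  simp only [Matrix.one_apply] at h1
  by_cases hc : x 0 = y 0
  · rw [hc] at h1 ⊢
    simp only [true_and]
    rw [← h1]
    cases y 0 <;> simp
  · cases hx : x 0 <;> cases hy : y 0 <;> simp_all

/-- The gate applying `W 0` or `W 1` to the qubit `t`, according to the value of the qubit `c`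
(a trivial gate if `c = t`). -/
def ctlGate (c t : Qubit n b w) (W : Bool → Matrix.unitaryGroup Bool ℂ) : Gate n b w :=
  if h : c ≠ t then
    .elementary 2 le_rfl (pairEmb c t h) ⟨ctlMatrix fun s => (W s).1, ctlMatrix_mem fun s => (W s).2⟩
  else .elementary 0 (by norm_num) ⟨Fin.elim0, fun i => i.elim0⟩ 1

theorem isCall_ctlGate (c t : Qubit n b w) (W : Bool → Matrix.unitaryGroup Bool ℂ) :
    (ctlGate c t W).isCall = false := by
  unfold ctlGate; split <;> rfl

/-- The superposition `φ 0 |z[t := 0]⟩ + φ 1 |z[t := 1]⟩`. -/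
def ket (z : Qubit n b w → Bool) (t : Qubit n b w) (φ : Bool → ℂ) : StateSpace n b w :=
  φ false • basisState (Function.update z t false) + φ true • basisState (Function.update z t true)

theorem ket_apply (z : Qubit n b w → Bool) (t : Qubit n b w) (φ : Bool → ℂ)
    (y : Qubit n b w → Bool) : ket z t φ y = if ∀ q, q ≠ t → y q = z q then φ (y t) else 0 := by
  have key : ∀ β, y = Function.update z t β ↔ (∀ q, q ≠ t → y q = z q) ∧ y t = β := by
    intro β
    rw [Function.eq_update_iff, and_comm]
  have aux : ∀ (P : Prop) (_ : Decidable (P ∧ y t = false)) (_ : Decidable (P ∧ y t = true))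
      (_ : Decidable P), ((φ false * if P ∧ y t = false then 1 else 0) +
        φ true * if P ∧ y t = true then 1 else 0) = if P then φ (y t) else 0 := by
    intro P _ _ _
    by_cases h : P <;> rcases Bool.eq_false_or_eq_true (y t) with hy | hy <;> simp [h, hy]
  simp only [ket, basisState, Pi.add_apply, Pi.smul_apply, Pi.single_apply, smul_eq_mul, key]
  exact aux _ _ _ _

theorem ket_single (z : Qubit n b w → Bool) (t : Qubit n b w) (β : Bool) :
    ket z t (Pi.single β 1) = basisState (Function.update z t β) := by
  cases β <;> simp [ket]

theorem ctlGate_mulVec_basisState (U : OracleMatrix n b) {c t : Qubit n b w} (h : c ≠ t)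
    (W : Bool → Matrix.unitaryGroup Bool ℂ) (z : Qubit n b w → Bool) :
    ((ctlGate c t W).toMatrix U).mulVec (basisState z)
      = ket z t (fun β => (W (z c)).1 β (z t)) := by
  funext y
  rw [basisState, Matrix.mulVec_single_one, ket_apply, ctlGate, dif_pos h]
  simp only [Gate.toMatrix, Matrix.col_apply, actOn, range_pairEmb, mem_insert_iff,
    mem_singleton_iff, not_or, ctlMatrix, Function.comp]
  have e0 : pairEmb c t h 0 = c := rfl
  have e1 : pairEmb c t h 1 = t := rfl
  rw [e0, e1]
  by_cases h1 : ∀ q, q ≠ t → y q = z q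
  · rw [if_pos (fun q hq => h1 q hq.2), if_pos h1, if_pos (h1 c h), h1 c h]
  · rw [if_neg h1]
    split_ifs with h2 h3
    · refine absurd (fun q hq => ?_) h1
      by_cases hqc : q = c
      · rw [hqc, h3]
      · exact h2 q ⟨hqc, hq⟩
    all_goals rfl

/-- Reduces gates with a common target and fixed controls to products of 2 × 2 matrices. -/
theorem ctlGate_mulVec_ket (U : OracleMatrix n b) {c t : Qubit n b w} (h : c ≠ t)
    (W : Bool → Matrix.unitaryGroup Bool ℂ) (z : Qubit n b w → Bool) (φ : Bool → ℂ) :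
    ((ctlGate c t W).toMatrix U).mulVec (ket z t φ) = ket z t ((W (z c)).1.mulVec φ) := by
  have hu : ∀ β, ((ctlGate c t W).toMatrix U).mulVec (basisState (Function.update z t β))
      = ket z t (fun γ => (W (z c)).1 γ β) := by
    intro β
    rw [ctlGate_mulVec_basisState U h, Function.update_of_ne h, Function.update_self]
    simp [ket]
  rw [ket, Matrix.mulVec_add, Matrix.mulVec_smul, Matrix.mulVec_smul, hu, hu]
  funext y
  simp only [Pi.add_apply, Pi.smul_apply, ket_apply, Matrix.mulVec, dotProduct, Fintype.sum_bool,
    smul_eq_mul]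
  split_ifs <;> ring

/-- The Hadamard matrix up to the phase `(1 + i) / √2`. -/
def phaseHadamard : Matrix.unitaryGroup Bool ℂ :=
  ⟨Matrix.of fun x y => (⟨1 / 2, 1 / 2⟩ : ℂ) * (if x && y then -1 else 1), by
    rw [Matrix.mem_unitaryGroup_iff]
    ext x y
    cases x <;> cases y <;>
      simp [Matrix.mul_apply, Complex.ext_iff] <;> norm_num⟩

/-- The Pauli matrix `Z`. -/
def pauliZ : Matrix.unitaryGroup Bool ℂ :=
  ⟨Matrix.diagonal fun x => if x then -1 else 1, by
    rw [Matrix.mem_unitaryGroup_iff]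
    ext x y
    cases x <;> cases y <;> simp [Matrix.star_eq_conjTranspose, Matrix.diagonal_conjTranspose]⟩

/-- The Pauli matrix `X`. -/
def pauliX : Matrix.unitaryGroup Bool ℂ :=
  ⟨Matrix.of fun x y => if x = y then 0 else 1, by
    rw [Matrix.mem_unitaryGroup_iff]
    ext x y
    cases x <;> cases y <;> simp [Matrix.mul_apply]⟩

/-! ### Reversible evaluation of a bit automaton -/

/-- A transition of a one-bit automaton: reading `x` in state `s`, it moves to
`neg xor (s = state ∧ x = bit)`. -/
structure Rule where
  neg : Bool
  state : Bool
  bit : Bool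

/-- The next state of the automaton. -/
def Rule.next (r : Rule) (s x : Bool) : Bool := xor r.neg (decide (s = r.state) && decide (x = r.bit))

/-- Gates that write `r.next s x` on the target `t`, where `s` and `x` are the values of the qubits
`p` and `q`. -/
def stepCircuit (r : Rule) (p q t : Qubit n b w) : List (Gate n b w) :=
  [ctlGate p t fun s => if s = r.state then phaseHadamard else 1,
   ctlGate q t fun x => if x = r.bit then pauliZ else 1,
   ctlGate p t fun s => (if r.neg then pauliX else 1) * (if s = r.state then phaseHadamard⁻¹ else 1)]

/-- A conjugated Z is an X: if both conditions hold, the target undergoes H⁻¹ZH = X; if only the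
first holds, H⁻¹H = 1; if the first fails, Z can only act on |0⟩, which it fixes. The phase of
`phaseHadamard` cancels against its inverse. -/
theorem evolve_stepCircuit (U : OracleMatrix n b) (r : Rule) {p q t : Qubit n b w} (hp : p ≠ t)
    (hq : q ≠ t) {z : Qubit n b w → Bool} (ht : z t = false) :
    evolve U (stepCircuit r p q t) (basisState z)
      = basisState (Function.update z t (r.next (z p) (z q))) := by
  have h0 : basisState z = ket z t (Pi.single false 1) := by
    rw [ket_single, ← ht, Function.update_eq_self]
  rw [h0, ← ket_single]
  simp only [stepCircuit, evolve_cons, ctlGate_mulVec_ket U hp, ctlGate_mulVec_ket U hq]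
  change ket z t _ = _
  congr 1
  obtain ⟨ν, α, β⟩ := r
  generalize z p = s
  generalize z q = x
  funext γ
  cases ν <;> cases α <;> cases β <;> cases s <;> cases x <;> cases γ <;>
    simp [Rule.next, phaseHadamard, pauliX, pauliZ, Matrix.mulVec, dotProduct, Matrix.mul_apply,
      Complex.ext_iff] <;> norm_num

/-- The `k`-th workspace qubit. -/
def wire (k : ℕ) : Qubit n b (w + 1) := Sum.inr (Fin.ofNat (w + 1) k)

theorem wire_ne {i j : ℕ} (hi : i ≤ w) (hj : j ≤ w) (h : i ≠ j) :
    (wire i : Qubit n b (w + 1)) ≠ wire j := by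
  simp only [wire, ne_eq, Sum.inr.injEq, Fin.ext_iff, Fin.val_ofNat]
  rwa [Nat.mod_eq_of_lt (by omega), Nat.mod_eq_of_lt (by omega)]

/-- Run an automaton that reads the listed qubits; its states are written on consecutive wires. -/
def chainCircuit : ℕ → List (Qubit n b (w + 1) × Rule) → List (Gate n b (w + 1))
  | _, [] => []
  | k, p :: l => stepCircuit p.2 (wire k) p.1 (wire (k + 1)) ++ chainCircuit (k + 1) l

/-- The final state of the automaton. -/
def runRules {Q : Type} (l : List (Q × Rule)) (s : Bool) (z : Q → Bool) : Bool :=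
  l.foldl (fun s p => p.2.next s (z p.1)) s

theorem runRules_congr {Q : Type} {l : List (Q × Rule)} (s : Bool) {z z' : Q → Bool}
    (h : ∀ p ∈ l, z p.1 = z' p.1) : runRules l s z = runRules l s z' := by
  induction l generalizing s with
  | nil => rfl
  | cons p l ih =>
    simp only [runRules, List.foldl_cons]
    rw [h p (by simp)]
    exact ih _ fun p' hp' => h p' (by simp [hp'])

/-- Only the last wire of z' is described, since the intermediate states are uncomputed later. -/
theorem evolve_chainCircuit (U : OracleMatrix n b) (l : List (Qubit n b (w + 1) × Rule)) (k : ℕ)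
    (hk : k + l.length ≤ w) (hl : ∀ p ∈ l, ∀ j, k < j → j ≤ w → p.1 ≠ wire j)
    {z : Qubit n b (w + 1) → Bool} (hz : ∀ j, k < j → j ≤ w → z (wire j) = false) :
    ∃ z', evolve U (chainCircuit k l) (basisState z) = basisState z' ∧
      z' (wire (k + l.length)) = runRules l (z (wire k)) z := by
  induction l generalizing k z with
  | nil => exact ⟨z, rfl, rfl⟩
  | cons p l ih =>
    simp only [List.length_cons] at hk
    have hw : (wire k : Qubit n b (w + 1)) ≠ wire (k + 1) := wire_ne (by omega) (by omega) (by omega)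
    have hp : p.1 ≠ wire (k + 1) := hl p (by simp) _ (by omega) (by omega)
    obtain ⟨z', h1, h2⟩ := ih (k + 1) (by omega)
      (fun p' hp' j hj hj' => hl p' (by simp [hp']) j (by omega) hj')
      (z := Function.update z (wire (k + 1)) (p.2.next (z (wire k)) (z p.1))) (by
        intro j hj hj'
        rw [Function.update_of_ne (wire_ne hj' (by omega) (by omega))]
        exact hz j (by omega) hj')
    refine ⟨z', ?_, ?_⟩
    · rw [chainCircuit, evolve_append,
        evolve_stepCircuit U _ hw hp (hz _ (by omega) (by omega)), h1]
    · rw [List.length_cons, show k + (l.length + 1) = k + 1 + l.length by ring, h2,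
        Function.update_self]
      simp only [runRules, List.foldl_cons]
      refine runRules_congr _ fun p' hp' => Function.update_of_ne ?_ _ _
      exact hl p' (by simp [hp']) _ (by omega) (by omega)

/-- Multiply basis states by `-1` if the automaton accepts. -/
def phaseCircuit (l : List (Qubit n b (w + 1) × Rule)) : List (Gate n b (w + 1)) :=
  chainCircuit 1 l ++
    -- A plain Z on the result wire; the control `wire 0` is a dummy. Wire 1 holds the initial state
    -- of the automaton.
    (ctlGate (wire 0) (wire (1 + l.length)) (fun _ => pauliZ) :: invCircuit (chainCircuit 1 l))

theorem evolve_phaseCircuit_basisState {U : OracleMatrix n b}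
    (hU : U ∈ Matrix.unitaryGroup (Fin n ⊕ Fin b → Bool) ℂ)
    (l : List (Qubit n b (w + 1) × Rule)) (hk : 1 + l.length ≤ w)
    (hl : ∀ p ∈ l, ∀ j, 1 < j → j ≤ w → p.1 ≠ wire j)
    {z : Qubit n b (w + 1) → Bool} (hz : ∀ j, 1 ≤ j → j ≤ w → z (wire j) = false) :
    evolve U (phaseCircuit l) (basisState z)
      = (if runRules l false z then -1 else 1 : ℂ) • basisState z := by
  obtain ⟨z', h1, h2⟩ := evolve_chainCircuit U l 1 hk hl (z := z)
    (fun j hj hj' => hz j (by omega) hj')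
  have hne : (wire 0 : Qubit n b (w + 1)) ≠ wire (1 + l.length) :=
    wire_ne (by omega) (by omega) (by omega)
  have h3 : ((ctlGate (wire 0) (wire (1 + l.length)) (fun _ => pauliZ)).toMatrix U).mulVec
      (basisState z') = (if runRules l false z then -1 else 1 : ℂ) • basisState z' := by
    rw [ctlGate_mulVec_basisState U hne]
    rw [hz 1 le_rfl (by omega)] at h2
    rw [← h2]
    have hb : basisState z' = ket z' (wire (1 + l.length))
        (Pi.single (z' (wire (1 + l.length))) 1) := by rw [ket_single, Function.update_eq_self]
    conv_rhs => rw [hb]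
    cases z' (wire (1 + l.length)) <;> simp [ket, pauliZ]
  rw [phaseCircuit, evolve_append, h1, evolve_cons, h3, map_smul, ← h1, evolve_invCircuit hU]

theorem eq_sum_basisState (v : StateSpace n b w) : v = ∑ z, v z • basisState z := by
  funext y
  simp [basisState, Finset.sum_apply, Pi.single_apply]

/-- Linear extension of the basis case: basis states with a dirty workspace have amplitude 0 in v,
so the circuit's action on them is irrelevant. -/
theorem evolve_phaseCircuit {U : OracleMatrix n b}
    (hU : U ∈ Matrix.unitaryGroup (Fin n ⊕ Fin b → Bool) ℂ)
    (l : List (Qubit n b (w + 1) × Rule)) (hk : 1 + l.length ≤ w)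
    (hl : ∀ p ∈ l, ∀ j, 1 < j → j ≤ w → p.1 ≠ wire j)
    {v : StateSpace n b (w + 1)} (hv : ∀ j, 1 ≤ j → j ≤ w → v ∈ zeroAt (wire j)) :
    evolve U (phaseCircuit l) v = fun z => (if runRules l false z then -1 else 1 : ℂ) * v z := by
  rw [eq_sum_basisState fun z => (if runRules l false z then -1 else 1 : ℂ) * v z]
  conv_lhs => rw [eq_sum_basisState v]
  rw [map_sum]
  refine Finset.sum_congr rfl fun z _ => ?_
  rw [map_smul]
  by_cases hz : ∀ j, 1 ≤ j → j ≤ w → z (wire j) = false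
  · rw [evolve_phaseCircuit_basisState hU l hk hl hz, smul_smul, mul_comm]
  · push Not at hz
    obtain ⟨j, h1, h2, h3⟩ := hz
    have : v z = 0 := hv j h1 h2 z (by simpa using h3)
    simp [this]

theorem length_chainCircuit (k : ℕ) (l : List (Qubit n b (w + 1) × Rule)) :
    (chainCircuit k l).length = 3 * l.length := by
  induction l generalizing k with
  | nil => rfl
  | cons p l ih => simp [chainCircuit, stepCircuit, ih]; ring

theorem countP_chainCircuit (k : ℕ) (l : List (Qubit n b (w + 1) × Rule)) :
    (chainCircuit k l).countP Gate.isCall = 0 := by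
  induction l generalizing k with
  | nil => rfl
  | cons p l ih => simp [chainCircuit, stepCircuit, ih, isCall_ctlGate]

theorem length_phaseCircuit (l : List (Qubit n b (w + 1) × Rule)) :
    (phaseCircuit l).length = 6 * l.length + 1 := by
  simp [phaseCircuit, length_invCircuit, length_chainCircuit]; ring

theorem countP_phaseCircuit (l : List (Qubit n b (w + 1) × Rule)) :
    (phaseCircuit l).countP Gate.isCall = 0 := by
  simp [phaseCircuit, countP_invCircuit, countP_chainCircuit, isCall_ctlGate]

end Automata

section Amplification

/-! ### Comparison and zero test as automata -/

/-- Transition computing the disjunction of state and bit. -/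
def orRule : Rule := ⟨true, false, false⟩

/-- Transition computing the conjunction of the state and the negated bit. -/
def clearRule : Rule := ⟨false, true, false⟩

/-- Transition updating the result of a comparison with a number whose current digit is `d`. -/
def ltRule (d : Bool) : Rule := if d then ⟨true, false, true⟩ else clearRule

theorem orRule_next (s x : Bool) : orRule.next s x = (s || x) := by
  cases s <;> cases x <;> rfl

theorem clearRule_next (s x : Bool) : clearRule.next s x = (s && !x) := by
  cases s <;> cases x <;> rfl

theorem ltRule_next (d s x : Bool) : (ltRule d).next s x = if d then s || !x else s && !x := by
  cases d <;> cases s <;> cases x <;> rfl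

theorem runRules_append {Q : Type} (l l' : List (Q × Rule)) (s : Bool) (z : Q → Bool) :
    runRules (l ++ l') s z = runRules l' (runRules l s z) z := by
  simp [runRules]

theorem runRules_orRule {Q : Type} (l : List Q) (s : Bool) (z : Q → Bool) :
    runRules (l.map fun q => (q, orRule)) s z = true ↔ s = true ∨ ∃ q ∈ l, z q = true := by
  induction l generalizing s with
  | nil => simp [runRules]
  | cons q l ih =>
    have := ih (orRule.next s (z q))
    simp only [runRules, List.map_cons, List.foldl_cons] at this ⊢
    rw [this, orRule_next]
    simp [or_assoc]

theorem runRules_clearRule {Q : Type} (l : List Q) (s : Bool) (z : Q → Bool) :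
    runRules (l.map fun q => (q, clearRule)) s z = true ↔ s = true ∧ ∀ q ∈ l, z q = false := by
  induction l generalizing s with
  | nil => simp [runRules]
  | cons q l ih =>
    have := ih (clearRule.next s (z q))
    simp only [runRules, List.map_cons, List.foldl_cons] at this ⊢
    rw [this, clearRule_next]
    simp [and_assoc]

theorem regValue_succ {n : ℕ} (x : Fin (n + 1) → Bool) :
    regValue x = regValue (fun i => x (Fin.castSucc i)) + if x (Fin.last n) then 2 ^ n else 0 := by
  simp [regValue, Fin.sum_univ_castSucc]

theorem regValue_lt {n : ℕ} (x : Fin n → Bool) : regValue x < 2 ^ n := by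
  induction n with
  | zero => simp [regValue]
  | succ n ih =>
    have := ih fun i => x (Fin.castSucc i)
    rw [regValue_succ, pow_succ]
    split_ifs <;> omega

theorem regValue_injective {n : ℕ} : Function.Injective (regValue (n := n)) := by
  induction n with
  | zero => intro x y _; exact Subsingleton.elim _ _
  | succ n ih =>
    intro x y h
    have hx := regValue_lt fun i => x (Fin.castSucc i)
    have hy := regValue_lt fun i => y (Fin.castSucc i)
    rw [regValue_succ, regValue_succ] at h
    have hl : x (Fin.last n) = y (Fin.last n) := by
      cases h1 : x (Fin.last n) <;> cases h2 : y (Fin.last n) <;> simp [h1, h2] at h ⊢ <;> omega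
    rw [hl] at h
    have hc := ih (Nat.add_right_cancel h)
    funext i
    refine Fin.lastCases hl (fun j => ?_) i
    exact congrFun hc j

theorem sum_regValue {n : ℕ} (g : ℕ → ℝ) :
    ∑ x : Fin n → Bool, g (regValue x) = ∑ j ∈ Finset.range (2 ^ n), g j := by
  have himg : Finset.univ.image (regValue (n := n)) = Finset.range (2 ^ n) := by
    apply Finset.eq_of_subset_of_card_le
    · intro j hj
      obtain ⟨x, -, rfl⟩ := Finset.mem_image.1 hj
      simpa using regValue_lt x
    · rw [Finset.card_image_of_injective _ regValue_injective]
      simp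
  rw [← himg, Finset.sum_image fun x _ y _ h => regValue_injective h]

/-- Digits are read from the least significant one, so each new digit overrides the comparison so
far unless it equals the digit of X. -/
theorem foldl_ltRule {n : ℕ} (x : Fin n → Bool) (X : ℕ) :
    (List.finRange n).foldl (fun s (i : Fin n) => (ltRule (X.testBit i)).next s (x i)) false
      = decide (regValue x < X % 2 ^ n) := by
  induction n with
  | zero => simp [regValue, Nat.mod_one]
  | succ n ih =>
    have h := ih fun i => x (Fin.castSucc i)
    have hd : X / 2 ^ n % 2 = if X.testBit n then 1 else 0 := by
      rw [Nat.testBit_eq_decide_div_mod_eq]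
      rcases Nat.mod_two_eq_zero_or_one (X / 2 ^ n) with h | h <;> simp [h]
    rw [List.finRange_succ_last, List.foldl_append, List.foldl_map]
    simp only [Fin.val_castSucc, List.foldl_cons, List.foldl_nil, Fin.val_last]
    rw [h, ltRule_next, regValue_succ, Nat.mod_pow_succ, hd]
    have h1 := regValue_lt fun i => x (Fin.castSucc i)
    clear h ih hd
    have h2 : X % 2 ^ n < 2 ^ n := Nat.mod_lt _ (by positivity)
    generalize regValue (fun i => x (Fin.castSucc i)) = r at *
    generalize X % 2 ^ n = s at *
    generalize 2 ^ n = t at *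
    cases X.testBit n <;> cases x (Fin.last n) <;> simp <;> omega

/-! ### The circuits of amplitude amplification -/

variable {n b : ℕ}

/-- The register: main and ancilla qubits, a damping qubit, and the wires of the automata. -/
abbrev WorkQubit (n b : ℕ) : Type := Qubit n b (n + b + 2 + 1)

/-- Main and ancilla qubits and the damping qubit. -/
def dataQubits (n b : ℕ) : List (WorkQubit n b) :=
  (List.finRange n).map (fun i => Sum.inl (Sum.inl i)) ++
    ((List.finRange b).map (fun i => Sum.inl (Sum.inr i)) ++ [wire 0])

/-- The automaton that accepts all nonzero data. -/
def zeroTest (n b : ℕ) : List (WorkQubit n b × Rule) := (dataQubits n b).map fun q => (q, orRule)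

/-- The automaton that accepts a main register below `X`, with ancilla and damping qubits `0`. -/
def goodTest (n b X : ℕ) : List (WorkQubit n b × Rule) :=
  (List.finRange n).map (fun i : Fin n => (Sum.inl (Sum.inl i), ltRule (X.testBit i))) ++
    ((List.finRange b).map (fun i => Sum.inl (Sum.inr i)) ++ [wire 0]).map fun q => (q, clearRule)

theorem length_zeroTest : (zeroTest n b).length = n + b + 1 := by
  simp [zeroTest, dataQubits]; ring

theorem length_goodTest (X : ℕ) : (goodTest n b X).length = n + b + 1 := by
  simp [goodTest]; ring

theorem ne_wire_of_mem_dataQubits {q : WorkQubit n b} (hq : q ∈ dataQubits n b) {j : ℕ} (hj : 1 < j)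
    (hj' : j ≤ n + b + 2) : q ≠ wire j := by
  simp only [dataQubits, List.mem_append, List.mem_map, List.mem_singleton] at hq
  rcases hq with ⟨i, -, rfl⟩ | ⟨i, -, rfl⟩ | rfl
  · simp [wire]
  · simp [wire]
  · exact wire_ne (by omega) hj' (by omega)

theorem zeroTest_ne_wire (p) (hp : p ∈ zeroTest n b) (j : ℕ) (hj : 1 < j) (hj' : j ≤ n + b + 2) :
    p.1 ≠ wire j := by
  simp only [zeroTest, List.mem_map] at hp
  obtain ⟨q, hq, rfl⟩ := hp
  exact ne_wire_of_mem_dataQubits hq hj hj'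

theorem goodTest_ne_wire (X : ℕ) (p) (hp : p ∈ goodTest n b X) (j : ℕ) (hj : 1 < j)
    (hj' : j ≤ n + b + 2) : p.1 ≠ wire j := by
  refine ne_wire_of_mem_dataQubits ?_ hj hj'
  simp only [goodTest, List.mem_append, List.mem_map] at hp
  rw [dataQubits, List.mem_append]
  rcases hp with ⟨i, -, rfl⟩ | ⟨q, hq, rfl⟩
  · left; simp
  · right; simpa using hq

/-- Whether a measurement outcome passes the test. -/
def isGood (X : ℕ) (z : WorkQubit n b → Bool) : Bool := runRules (goodTest n b X) false z

theorem isGood_iff {X : ℕ} (hX : X < 2 ^ n) (z : WorkQubit n b → Bool) :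
    isGood X z = true ↔ regValue (fun i => z (Sum.inl (Sum.inl i))) < X ∧
      (∀ i, z (Sum.inl (Sum.inr i)) = false) ∧ z (wire 0) = false := by
  rw [isGood, goodTest, runRules_append, runRules_clearRule]
  have : runRules ((List.finRange n).map
      (fun i : Fin n => ((Sum.inl (Sum.inl i) : WorkQubit n b), ltRule (X.testBit i)))) false z
      = decide (regValue (fun i => z (Sum.inl (Sum.inl i))) < X) := by
    have h := foldl_ltRule (fun i => z (Sum.inl (Sum.inl i))) X
    rw [Nat.mod_eq_of_lt hX] at h
    rw [← h, runRules, List.foldl_map]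
  rw [this, decide_eq_true_iff]
  refine and_congr_right fun _ => ?_
  simp only [List.mem_append, List.mem_map, List.mem_finRange, true_and, List.mem_singleton]
  constructor
  · exact fun h => ⟨fun i => h _ (Or.inl ⟨i, rfl⟩), h _ (Or.inr rfl)⟩
  · rintro ⟨h1, h2⟩ q (⟨i, rfl⟩ | rfl)
    · exact h1 i
    · exact h2

/-- The reflection that sends `|0⟩` to `(5 |0⟩ + 12 |1⟩) / 13`. -/
def damping : Matrix.unitaryGroup Bool ℂ :=
  ⟨Matrix.of fun x y => if x = y then (if x then ⟨-5 / 13, 0⟩ else ⟨5 / 13, 0⟩) else ⟨12 / 13, 0⟩, by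
    rw [Matrix.mem_unitaryGroup_iff]
    ext x y
    cases x <;> cases y <;> simp [Matrix.mul_apply, Complex.ext_iff] <;> norm_num⟩

theorem exists_wire (i : Fin (n + b + 2 + 1)) (hi : i ≠ 0) :
    ∃ j, 1 ≤ j ∧ j ≤ n + b + 2 ∧ (Sum.inr i : WorkQubit n b) = wire j := by
  refine ⟨i, ?_, by omega, by simp [wire]⟩
  have : (i : ℕ) ≠ 0 := fun h => hi (Fin.ext h)
  omega

variable [NeZero n]

/-- Preparation of the damped encoded state. -/
def prepCircuit (n b : ℕ) [NeZero n] : List (Gate n b (n + b + 2 + 1)) :=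
  -- Both branches apply `damping`, so main qubit 0 is a dummy control; it exists because n ≠ 0.
  [ctlGate (Sum.inl (Sum.inl 0)) (wire 0) fun _ => damping, .call]

/-- One iteration of amplitude amplification. -/
def groverStep (n b X : ℕ) [NeZero n] : List (Gate n b (n + b + 2 + 1)) :=
  phaseCircuit (goodTest n b X) ++ (invCircuit (prepCircuit n b) ++
    (phaseCircuit (zeroTest n b) ++ prepCircuit n b))

/-- Preparation followed by `m` iterations. -/
def groverCircuit (n b X : ℕ) [NeZero n] : ℕ → List (Gate n b (n + b + 2 + 1))
  | 0 => prepCircuit n b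
  | m + 1 => groverCircuit n b X m ++ groverStep n b X

theorem ctl_ne : (Sum.inl (Sum.inl 0) : WorkQubit n b) ≠ wire 0 := by simp [wire]

/-- The preparation touches only main, ancilla and damping qubits, so the automata always find clean
wires. -/
theorem evolve_prep_mem_zeroAt (U : OracleMatrix n b) {j : ℕ} (h1 : 1 ≤ j) (h2 : j ≤ n + b + 2)
    {v : StateSpace n b (n + b + 2 + 1)} (hv : v ∈ zeroAt (wire j)) :
    evolve U (prepCircuit n b) v ∈ zeroAt (wire j) ∧
      evolve U (invCircuit (prepCircuit n b)) v ∈ zeroAt (wire j) := by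
  have hr : (wire j : WorkQubit n b) ∉ range (pairEmb _ _ (ctl_ne (n := n) (b := b))) := by
    rw [range_pairEmb]
    have : (wire j : WorkQubit n b) ≠ wire 0 := wire_ne h2 (by omega) (by omega)
    simp only [mem_insert_iff, mem_singleton_iff, not_or]
    exact ⟨by simp [wire], this⟩
  have hi : (wire j : WorkQubit n b) ∉ range (Function.Embedding.inl :
      (Fin n ⊕ Fin b) ↪ WorkQubit n b) := by
    rintro ⟨x, hx⟩
    simp [wire] at hx
  simp only [prepCircuit, ctlGate, dif_pos ctl_ne]
  constructor
  · exact actOn_mulVec_mem_zeroAt _ _ hi (actOn_mulVec_mem_zeroAt _ _ hr hv)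
  · exact actOn_mulVec_mem_zeroAt _ _ hr (actOn_mulVec_mem_zeroAt _ _ hi hv)

/-! ### The prepared state and its weight on good outcomes -/

/-- The damped encoded state. -/
def prepState (U : OracleMatrix n b) : StateSpace n b (n + b + 2 + 1) :=
  evolve U (prepCircuit n b) (basisState (zeroBits _))

theorem prepState_mem_zeroAt (U : OracleMatrix n b) {j : ℕ} (h1 : 1 ≤ j) (h2 : j ≤ n + b + 2) :
    prepState U ∈ zeroAt (wire j) := by
  refine (evolve_prep_mem_zeroAt U h1 h2 ?_).1
  intro z hz
  simp only [basisState, Pi.single_apply]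
  rw [if_neg]
  rintro rfl
  simp [zeroBits] at hz

theorem prepState_apply (U : OracleMatrix n b) {z : WorkQubit n b → Bool}
    (hz : ∀ i, i ≠ 0 → z (Sum.inr i) = false) :
    prepState U z = U (z ∘ Sum.inl) (zeroBits _) * damping.1 (z (wire 0)) false := by
  simp only [prepState, prepCircuit, evolve_cons, ctlGate_mulVec_basisState U ctl_ne]
  change (actOn _ U).mulVec _ z = _
  rw [actOn_mulVec, Finset.sum_eq_single (zeroBits _)]
  · rw [ket_apply, if_pos]
    · rw [Function.extend_apply' _ _ _ (by simp [wire])]; rfl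
    · intro q hq
      rcases q with q | i
      · exact Function.Embedding.inl.injective.extend_apply _ _ q
      · rw [Function.extend_apply' _ _ _ (by simp)]
        refine hz i ?_
        rintro rfl
        exact hq (by simp [wire])
  · intro s _ hs
    rw [ket_apply, if_neg, mul_zero]
    intro h
    refine hs ?_
    funext q
    have := h (Sum.inl q) (by simp [wire])
    rwa [show (Sum.inl q : WorkQubit n b) = Function.Embedding.inl q from rfl,
      Function.Embedding.inl.injective.extend_apply] at this
  · simp

theorem sum_norm_sq_prepState {U : OracleMatrix n b}
    (hU : U ∈ Matrix.unitaryGroup (Fin n ⊕ Fin b → Bool) ℂ) :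
    ∑ z, ‖prepState U z‖ ^ 2 = 1 := by
  rw [prepState, ← finalState_eq]
  exact sum_norm_sq_finalState hU _

/-- The probability that the damped encoded state passes the test. -/
def goodWeight (U : OracleMatrix n b) (X : ℕ) : ℝ :=
  ∑ z, if isGood X z then ‖prepState U z‖ ^ 2 else 0

/-- Good basis states with nonzero amplitude have all qubits outside the main register 0, and there
the amplitude is 5/13 times the encoded one. -/
theorem goodWeight_eq {U : OracleMatrix n b} {X : ℕ} (hX : X < 2 ^ n) {a : ℝ} {ψ : ℝ → ℝ}
    (h : EncodesWithSubnorm U a ψ) (hN : 0 < gridNormSq n ψ) :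
    goodWeight U X = (5 / 13 * a) ^ 2 *
      ((∑ j ∈ Finset.range X, ψ (gridPoint n j) ^ 2) / gridNormSq n ψ) := by
  let ι : (Fin n → Bool) → (WorkQubit n b → Bool) := fun x =>
    Sum.elim (Sum.elim x (zeroBits _)) (zeroBits _)
  let g : ℕ → ℝ := fun j => if j < X then (5 / 13 * a) ^ 2 *
    (ψ (gridPoint n j) ^ 2 / gridNormSq n ψ) else 0
  have hsum : ∑ x : Fin n → Bool, g (regValue x) = goodWeight U X := by
    refine Fintype.sum_of_injective ι ?_ _ _ ?_ ?_
    · intro x y hxy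
      funext i
      exact congrFun hxy (Sum.inl (Sum.inl i))
    · intro z hz
      by_cases hg : isGood X z = true
      · rw [if_pos hg]
        rw [isGood_iff hX] at hg
        obtain ⟨-, h2, h3⟩ := hg
        suffices prepState U z = 0 by simp [this]
        by_contra hne
        refine hz ⟨fun i => z (Sum.inl (Sum.inl i)), ?_⟩
        funext q
        rcases q with (i | i) | i
        · rfl
        · exact (h2 i).symm
        · by_cases hi : i = 0
          · rw [hi]; exact h3.symm
          · obtain ⟨j, hj1, hj2, hj⟩ := exists_wire (n := n) (b := b) i hi
            rw [hj]
            by_contra hc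
            refine hne (prepState_mem_zeroAt U hj1 hj2 z ?_)
            cases hv : z (wire j) with
            | true => rfl
            | false => exact absurd hv.symm hc
      · rw [if_neg hg]
    · intro x
      have hgood : isGood X (ι x) = true ↔ regValue x < X := by
        rw [isGood_iff hX]
        simp [ι, zeroBits, wire]
      simp only [g, hgood]
      refine if_congr Iff.rfl ?_ rfl
      rw [prepState_apply U (by intro i _; rfl)]
      have e : ι x ∘ Sum.inl = Sum.elim x (zeroBits (Fin b)) := rfl
      rw [e, h.2 x]
      have hd : damping.1 (ι x (wire 0)) false = ((5 / 13 : ℝ) : ℂ) := by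
        simp [ι, wire, zeroBits, damping, Complex.ext_iff]
      rw [hd, ← Complex.ofReal_mul, Complex.norm_real, Real.norm_eq_abs, sq_abs, encodedState]
      simp only [mul_pow, div_pow, Real.sq_sqrt hN.le]
      ring
  rw [← hsum, sum_regValue, Finset.sum_div, Finset.mul_sum]
  simp only [g]
  rw [← Finset.sum_filter]
  refine Finset.sum_congr ?_ fun _ _ => rfl
  ext j
  simp only [Finset.mem_filter, Finset.mem_range]
  omega

/-! ### The Grover iteration as a rotation -/

/-- The part of the prepared state passing the test, times `α`, plus `β` times the rest. -/
def mixState (U : OracleMatrix n b) (X : ℕ) (α β : ℝ) : StateSpace n b (n + b + 2 + 1) :=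
  fun z => ((if isGood X z then α else β : ℝ) : ℂ) * prepState U z

theorem mixState_mem_zeroAt (U : OracleMatrix n b) (X : ℕ) (α β : ℝ) {j : ℕ} (h1 : 1 ≤ j)
    (h2 : j ≤ n + b + 2) : mixState U X α β ∈ zeroAt (wire j) := by
  intro z hz
  rw [mixState, prepState_mem_zeroAt U h1 h2 z hz, mul_zero]

theorem herm_prepState_mixState {U : OracleMatrix n b}
    (hU : U ∈ Matrix.unitaryGroup (Fin n ⊕ Fin b → Bool) ℂ) (X : ℕ) (α β : ℝ) :
    herm (prepState U) (mixState U X α β)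
      = ((α * goodWeight U X + β * (1 - goodWeight U X) : ℝ) : ℂ) := by
  have h : herm (prepState U) (mixState U X α β)
      = ((∑ z, (if isGood X z then α else β) * ‖prepState U z‖ ^ 2 : ℝ) : ℂ) := by
    simp only [herm, dotProduct, Pi.star_apply, Complex.ofReal_sum, mixState]
    refine Finset.sum_congr rfl fun z _ => ?_
    rw [Complex.ofReal_mul, ← Complex.normSq_eq_norm_sq, ← Complex.mul_conj, Complex.star_def]
    ring
  rw [h, ← sum_norm_sq_prepState hU, goodWeight, ← Finset.sum_sub_distrib, Finset.mul_sum,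
    Finset.mul_sum, ← Finset.sum_add_distrib]
  congr 1
  refine Finset.sum_congr rfl fun z _ => ?_
  split_ifs <;> ring

/-- The reflection 2|0⟩⟨0| - 1. The wires from 1 on are 0 in u, so testing the data qubits is
enough. -/
theorem evolve_zeroTest {U : OracleMatrix n b}
    (hU : U ∈ Matrix.unitaryGroup (Fin n ⊕ Fin b → Bool) ℂ) {u : StateSpace n b (n + b + 2 + 1)}
    (hu : ∀ j, 1 ≤ j → j ≤ n + b + 2 → u ∈ zeroAt (wire j)) :
    evolve U (phaseCircuit (zeroTest n b)) u
      = (2 * u (zeroBits _)) • basisState (zeroBits _) - u := by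
  rw [evolve_phaseCircuit hU _ (by rw [length_zeroTest]; omega) zeroTest_ne_wire hu]
  funext z
  simp only [Pi.sub_apply, Pi.smul_apply, basisState, Pi.single_apply, smul_eq_mul]
  have hrun : runRules (zeroTest n b) false z = true ↔ ∃ q ∈ dataQubits n b, z q = true := by
    rw [zeroTest, runRules_orRule]; simp
  by_cases hz : z = zeroBits _
  · rw [if_pos hz, if_neg (by rw [hrun, hz]; simp [zeroBits]), hz]; ring
  rw [if_neg hz]
  by_cases hr : runRules (zeroTest n b) false z = true
  · rw [if_pos hr]; ring
  · suffices u z = 0 by simp [this]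
    rw [hrun] at hr
    push Not at hr
    by_contra hne
    refine hz ?_
    funext q
    have hd : ∀ q ∈ dataQubits n b, z q = false := fun q hq => by simpa using hr q hq
    rcases q with (i | i) | i
    · exact hd _ (by simp [dataQubits])
    · exact hd _ (by simp [dataQubits])
    · by_cases hi : i = 0
      · exact hd _ (by simp [dataQubits, wire, hi])
      · obtain ⟨j, hj1, hj2, hj⟩ := exists_wire (n := n) (b := b) i hi
        rw [hj]
        by_contra hc
        exact hne (hu j hj1 hj2 z (by simpa [zeroBits] using hc))

/-- The good test changes α to -α. Conjugating the zero test by the preparation reflects about the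
prepared state s, sending v to 2⟨s, v⟩s - v. -/
theorem evolve_groverStep {U : OracleMatrix n b}
    (hU : U ∈ Matrix.unitaryGroup (Fin n ⊕ Fin b → Bool) ℂ) (X : ℕ) (α β : ℝ) :
    evolve U (groverStep n b X) (mixState U X α β)
      = mixState U X (2 * (-α * goodWeight U X + β * (1 - goodWeight U X)) + α)
        (2 * (-α * goodWeight U X + β * (1 - goodWeight U X)) - β) := by
  have h1 : evolve U (phaseCircuit (goodTest n b X)) (mixState U X α β)
      = mixState U X (-α) β := by
    rw [evolve_phaseCircuit hU _ (by rw [length_goodTest]; omega) (goodTest_ne_wire X)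
      fun j hj hj' => mixState_mem_zeroAt U X α β hj hj']
    funext z
    simp only [mixState]
    rw [← isGood]
    split_ifs <;> simp
  rw [groverStep, evolve_append, h1, evolve_append, evolve_append, evolve_zeroTest hU
    fun j hj hj' => (evolve_prep_mem_zeroAt U hj hj' (mixState_mem_zeroAt U X _ _ hj hj')).2]
  rw [map_sub, map_smul, evolve_evolve_invCircuit hU, ← herm_basisState_left (zeroBits _) (evolve U _ _), ← herm_evolve,
    ← prepState, herm_prepState_mixState hU]
  funext z
  simp only [Pi.sub_apply, Pi.smul_apply, mixState, smul_eq_mul]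
  split_ifs <;> push_cast <;> ring

/-- Each iteration rotates the angle by 2θ. Stating the coefficients multiplied by sin θ and cos θ
avoids division when either part of the state vanishes. -/
theorem evolve_groverCircuit {U : OracleMatrix n b}
    (hU : U ∈ Matrix.unitaryGroup (Fin n ⊕ Fin b → Bool) ℂ) {X : ℕ} {θ : ℝ}
    (hθ : Real.sin θ ^ 2 = goodWeight U X) (m : ℕ) :
    ∃ α β : ℝ, finalState U (groverCircuit n b X m) = mixState U X α β ∧
      α * Real.sin θ = Real.sin ((2 * m + 1) * θ) ∧
      β * Real.cos θ = Real.cos ((2 * m + 1) * θ) := by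
  induction m with
  | zero =>
    refine ⟨1, 1, ?_, by simp, by simp⟩
    rw [finalState_eq]
    funext z
    simp [mixState, groverCircuit, prepState]
  | succ m ih =>
    obtain ⟨α, β, h1, h2, h3⟩ := ih
    rw [finalState_eq] at h1
    refine ⟨_, _, by rw [finalState_eq, groverCircuit, evolve_append, h1, evolve_groverStep hU],
      ?_, ?_⟩
    all_goals
      push_cast
      rw [show (2 * ((m : ℝ) + 1) + 1) * θ = (2 * m + 1) * θ + 2 * θ by ring]
    · rw [Real.sin_add, ← h2, ← h3, Real.sin_two_mul, Real.cos_two_mul, ← hθ]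
      linear_combination (-2 * α * Real.sin θ) * Real.sin_sq_add_cos_sq θ
        - 2 * β * Real.sin θ * Real.sin_sq_add_cos_sq θ
    · rw [Real.cos_add, ← h2, ← h3, Real.sin_two_mul, Real.cos_two_mul, ← hθ]
      linear_combination (-2 * β * Real.cos θ) * Real.sin_sq_add_cos_sq θ

/-- The success probability after `m` iterations. -/
theorem sum_isGood_groverCircuit {U : OracleMatrix n b}
    (hU : U ∈ Matrix.unitaryGroup (Fin n ⊕ Fin b → Bool) ℂ) {X : ℕ} {θ : ℝ}
    (hθ : Real.sin θ ^ 2 = goodWeight U X) (m : ℕ) :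
    ∑ z, (if isGood X z then ‖finalState U (groverCircuit n b X m) z‖ ^ 2 else 0)
      = Real.sin ((2 * m + 1) * θ) ^ 2 := by
  obtain ⟨α, β, h1, h2, -⟩ := evolve_groverCircuit hU hθ m
  rw [← h2, mul_pow, hθ, goodWeight, Finset.mul_sum, h1]
  refine Finset.sum_congr rfl fun z _ => ?_
  by_cases hg : isGood X z = true
  · simp only [if_pos hg, mixState]
    rw [norm_mul, Complex.norm_real, Real.norm_eq_abs, mul_pow, sq_abs]
  · simp [hg]

theorem length_groverCircuit (X m : ℕ) :
    (groverCircuit n b X m).length = (12 * (n + b + 1) + 6) * m + 2 := by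
  induction m with
  | zero => simp [groverCircuit, prepCircuit]
  | succ m ih =>
    simp only [groverCircuit, groverStep, List.length_append, ih, length_phaseCircuit,
      length_goodTest, length_zeroTest, length_invCircuit]
    simp [prepCircuit]; ring

theorem countP_groverCircuit (X m : ℕ) :
    (groverCircuit n b X m).countP Gate.isCall = 2 * m + 1 := by
  have hp : (prepCircuit n b).countP Gate.isCall = 1 := by
    rw [prepCircuit, List.countP_cons, isCall_ctlGate]; rfl
  induction m with
  | zero => exact hp
  | succ m ih =>
    simp only [groverCircuit, groverStep, List.countP_append, ih, countP_phaseCircuit,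
      countP_invCircuit, hp]
    ring

end Amplification

section Search

variable {n b : ℕ}

/-! ### Repeated tests -/

theorem Algorithm.prob_nonneg (U : OracleMatrix n b) (T : Set ℝ) (A : Algorithm n b) :
    0 ≤ A.prob U T := by
  induction A with
  | output r => simp only [Algorithm.prob]; split_ifs <;> norm_num
  | run w c next ih =>
    exact Finset.sum_nonneg fun z _ => mul_nonneg (sq_nonneg _) (ih z)

variable [NeZero n]

/-- Run the test with `m` iterations `L` times and continue with `c` plus the number of
successes. -/
def sample (X m : ℕ) : ℕ → ℕ → (ℕ → Algorithm n b) → Algorithm n b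
  | 0, c, k => k c
  | L + 1, c, k => .run _ (groverCircuit n b X m) fun z =>
      sample X m L (c + if isGood X z then 1 else 0) k

/-- A Chernoff bound for `sample`. -/
theorem le_prob_sample {U : OracleMatrix n b}
    (hU : U ∈ Matrix.unitaryGroup (Fin n ⊕ Fin b → Bool) ℂ) {X : ℕ} {θ : ℝ}
    (hθ : Real.sin θ ^ 2 = goodWeight U X) (m : ℕ) {S : Set ℝ} {k : ℕ → Algorithm n b}
    {η lam τ R : ℝ} (hη : 0 ≤ η) (hR : 0 ≤ R)
    (hk : ∀ c : ℕ, 1 - η ≤ (k c).prob U S ∨ 1 ≤ R * Real.exp (lam * (c - τ))) (L c : ℕ) :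
    1 - η - R * ((1 + Real.sin ((2 * m + 1) * θ) ^ 2 * (Real.exp lam - 1)) ^ L
      * Real.exp (lam * (c - τ))) ≤ (sample X m L c k).prob U S := by
  induction L generalizing c with
  | zero =>
    simp only [sample, pow_zero, one_mul]
    rcases hk c with h | h
    · linarith [mul_nonneg hR (Real.exp_pos (lam * (c - τ))).le]
    · linarith [Algorithm.prob_nonneg U S (k c)]
  | succ L ih =>
    simp only [sample, Algorithm.prob]
    set p := Real.sin ((2 * m + 1) * θ) ^ 2 with hp
    set Y := (1 + p * (Real.exp lam - 1)) ^ L with hY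
    -- The exponential is a potential: a success multiplies it by e^lam. Averaging over one
    -- measurement gives the factor 1 + p(e^lam - 1), by which the induction advances.
    have hstep : ∀ z, ‖finalState U (groverCircuit n b X m) z‖ ^ 2 * (1 - η
        - R * (Y * Real.exp (lam * (c - τ))))
        - (R * Y * Real.exp (lam * (c - τ)) * (Real.exp lam - 1)) *
          (if isGood X z then ‖finalState U (groverCircuit n b X m) z‖ ^ 2 else 0)
        ≤ ‖finalState U (groverCircuit n b X m) z‖ ^ 2 *
          (sample X m L (c + if isGood X z then 1 else 0) k).prob U S := by
      intro z
      refine le_trans (le_of_eq ?_) (mul_le_mul_of_nonneg_left (ih _) (sq_nonneg _))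
      split_ifs
      · push_cast
        rw [show lam * (c + 1 - τ) = lam * (c - τ) + lam by ring, Real.exp_add]
        ring
      · push_cast
        rw [add_zero]
        ring
    refine le_trans (le_of_eq ?_) (Finset.sum_le_sum fun z _ => hstep z)
    rw [Finset.sum_sub_distrib, ← Finset.sum_mul, ← Finset.mul_sum, sum_norm_sq_finalState hU,
      sum_isGood_groverCircuit hU hθ, ← hp, pow_succ, ← hY]
    ring

theorem queryCost_sample_le (X m : ℕ) {k : ℕ → Algorithm n b} {B : ℕ}
    (hk : ∀ c, (k c).queryCost ≤ B) (L c : ℕ) :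
    (sample X m L c k).queryCost ≤ L * (2 * m + 1) + B := by
  induction L generalizing c with
  | zero => simpa [sample] using hk c
  | succ L ih =>
    simp only [sample, Algorithm.queryCost, countP_groverCircuit]
    have : (Finset.univ.sup fun z : WorkQubit n b → Bool =>
        (sample X m L (c + if isGood X z then 1 else 0) k).queryCost) ≤ L * (2 * m + 1) + B :=
      Finset.sup_le fun z _ => ih _
    linarith

theorem gateCost_sample_le (X m : ℕ) {k : ℕ → Algorithm n b} {B : ℕ}
    (hk : ∀ c, (k c).gateCost ≤ B) (L c : ℕ) :
    (sample X m L c k).gateCost ≤ L * (18 * (n + b + 1) * (2 * m + 1)) + B := by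
  induction L generalizing c with
  | zero => simpa [sample] using hk c
  | succ L ih =>
    simp only [sample, Algorithm.gateCost, length_groverCircuit]
    have : (Finset.univ.sup fun z : WorkQubit n b → Bool =>
        (sample X m L (c + if isGood X z then 1 else 0) k).gateCost)
          ≤ L * (18 * (n + b + 1) * (2 * m + 1)) + B :=
      Finset.sup_le fun z _ => ih _
    have h2 : (12 * (n + b + 1) + 6) * m + 2 ≤ 18 * (n + b + 1) * (2 * m + 1) := by
      ring_nf
      nlinarith [Nat.zero_le (n * m), Nat.zero_le (b * m)]
    linarith

/-! ### Search for the angle -/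

/-- A test separating the outer thirds of `[l, l + w]`, if there is one. -/
def chosenTest (l w : ℝ) : ℕ × ℝ × ℝ :=
  open Classical in
  if h : ∃ t : ℕ × ℝ × ℝ, IsTest l w t.1 t.2.1 t.2.2 then h.choose else (0, 0, 1)

theorem isTest_chosenTest {l w : ℝ} (hl : 0 ≤ l) (hw : 0 < w) (hu : l + w ≤ 1 / 2) :
    IsTest l w (chosenTest l w).1 (chosenTest l w).2.1 (chosenTest l w).2.2 := by
  obtain ⟨m, τ, σ, h⟩ := exists_isTest hl hw hu
  have hex : ∃ t : ℕ × ℝ × ℝ, IsTest l w t.1 t.2.1 t.2.2 := ⟨(m, τ, σ), h⟩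
  rw [chosenTest, dif_pos hex]
  exact hex.choose_spec

open Classical in
/-- Shrink the interval `[l, l + w]` of possible angles by a third, `T` times; then return the
probability that belongs to the left end. -/
def search (b X L : ℕ) (a : ℝ) : ℕ → ℝ → ℝ → Algorithm n b
  | 0, l, _ => .output ((13 / 5 * Real.sin l / a) ^ 2)
  | T + 1, l, w => sample X (chosenTest l w).1 L 0 fun c =>
      if (chosenTest l w).2.2 * (c - L * (chosenTest l w).2.1) ≤ 0 then
        search b X L a T l (2 / 3 * w)
      else search b X L a T (l + w / 3) (2 / 3 * w)

/-- From e^lam ≤ 1 + lam + lam² and p ≤ 1, one Bernoulli trial has moment generating function at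
most exp(p lam + lam²). -/
theorem chernoff_factor_le {p lam d : ℝ} (hp0 : 0 ≤ p) (hp1 : p ≤ 1) (hlam : |lam| ≤ 1) (L : ℕ)
    {τ : ℝ} (hd : lam * (p - τ) + lam ^ 2 ≤ -d) :
    (1 + p * (Real.exp lam - 1)) ^ L * Real.exp (lam * ((0 : ℕ) - L * τ)) ≤ Real.exp (-(L * d)) := by
  have h1 : Real.exp lam - 1 - lam ≤ lam ^ 2 :=
    (le_abs_self _).trans (Real.abs_exp_sub_one_sub_id_le hlam)
  have h2 : 1 + p * (Real.exp lam - 1) ≤ Real.exp (p * lam + lam ^ 2) := by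
    have := Real.add_one_le_exp (p * lam + lam ^ 2)
    nlinarith [sq_nonneg lam]
  have h0 : 0 ≤ 1 + p * (Real.exp lam - 1) := by
    nlinarith [Real.exp_pos lam]
  calc _ ≤ Real.exp (p * lam + lam ^ 2) ^ L * Real.exp (lam * ((0 : ℕ) - L * τ)) := by gcongr
    _ = Real.exp (L * (lam * (p - τ) + lam ^ 2)) := by
      rw [← Real.exp_nat_mul, ← Real.exp_add]
      congr 1; push_cast; ring
    _ ≤ _ := by
      apply Real.exp_le_exp.2
      have : (L : ℝ) * (lam * (p - τ) + lam ^ 2) ≤ L * -d := by gcongr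
      linarith

/-- The rate in the error bound of a test. -/
def testRate : ℝ := (1 / 40000) ^ 2 / 4

/-- The two candidate intervals overlap in the middle third, so a decision is wrong only if θ is in
an outer third and the count lies on the wrong side. Such errors add up over the T stages. -/
theorem le_prob_search {U : OracleMatrix n b}
    (hU : U ∈ Matrix.unitaryGroup (Fin n ⊕ Fin b → Bool) ℂ) {X : ℕ} {θ : ℝ}
    (hθ : Real.sin θ ^ 2 = goodWeight U X) (L : ℕ) (a : ℝ) {S : Set ℝ} (T : ℕ) {l w : ℝ}
    (hl : 0 ≤ l) (hw : 0 < w) (hu : l + w ≤ 1 / 2) (h1 : l ≤ θ) (h2 : θ ≤ l + w)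
    (hS : ∀ l', 0 ≤ l' → l' ≤ θ → θ ≤ l' + (2 / 3) ^ T * w →
      (13 / 5 * Real.sin l' / a) ^ 2 ∈ S) :
    1 - T * Real.exp (-(L * testRate)) ≤ (search b X L a T l w : Algorithm n b).prob U S := by
  induction T generalizing l w with
  | zero =>
    simp only [search, Algorithm.prob]
    rw [if_pos (hS l hl h1 (by simpa using h2))]
    simp
  | succ T ih =>
    have ht := isTest_chosenTest hl hw hu
    simp only [search]
    set m := (chosenTest l w).1
    set τ := (chosenTest l w).2.1
    set σ := (chosenTest l w).2.2
    set E := Real.exp (-(L * testRate)) with hE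
    have hE0 : 0 ≤ E := (Real.exp_pos _).le
    set p := Real.sin ((2 * m + 1) * θ) ^ 2 with hp
    have hp0 : 0 ≤ p := sq_nonneg _
    have hp1 : p ≤ 1 := Real.sin_sq_le_one _
    have hσ2 : σ ^ 2 = 1 := by rcases ht.sign with h | h <;> rw [h] <;> norm_num
    have hσa : |σ| = 1 := by rcases ht.sign with h | h <;> rw [h] <;> norm_num
    have hT : ∀ l', (∃ e, 0 ≤ e ∧ e ≤ w / 3 ∧ l' = l + e) → l' ≤ θ → θ ≤ l' + 2 / 3 * w →
        1 - T * E ≤ (search b X L a T l' (2 / 3 * w) : Algorithm n b).prob U S := by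
      rintro l' ⟨e, he0, he1, rfl⟩ ha hb
      refine ih (by linarith) (by linarith) (by linarith) ha hb fun l'' g0 g1 g2 => ?_
      exact hS l'' g0 g1 (by rw [pow_succ, mul_assoc]; exact g2)
    have hleft := hT l ⟨0, by linarith, by linarith, by ring⟩ h1
    have hright := hT (l + w / 3) ⟨w / 3, by linarith, by linarith, rfl⟩
    obtain ⟨lam, R, hR, hd, hk⟩ : ∃ lam R : ℝ, 0 ≤ R ∧
        R * ((1 + p * (Real.exp lam - 1)) ^ L * Real.exp (lam * ((0 : ℕ) - L * τ))) ≤ E ∧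
        ∀ c : ℕ, 1 - T * E ≤ ((if σ * (c - L * τ) ≤ 0 then search b X L a T l (2 / 3 * w)
          else search b X L a T (l + w / 3) (2 / 3 * w) : Algorithm n b)).prob U S ∨
          1 ≤ R * Real.exp (lam * (c - L * τ)) := by
      by_cases hside : θ ≤ l + w / 3
      -- With margin g = 1/40000, the choice |lam| = g/2 maximises g|lam| - lam², with value g²/4 =
      -- `testRate`.
      · refine ⟨σ * (1 / 80000), 1, zero_le_one, ?_, fun c => ?_⟩
        · rw [one_mul]
          refine chernoff_factor_le hp0 hp1 ?_ L ?_
          · rw [abs_mul, hσa]; norm_num [abs_of_pos]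
          · have := ht.left θ h1 hside
            rw [mul_pow, hσ2, testRate]
            linarith
        · by_cases hc : σ * (c - L * τ) ≤ 0
          · left; rw [if_pos hc]; exact hleft (by linarith)
          · right
            rw [one_mul]
            push Not at hc
            exact Real.one_le_exp (by nlinarith)
      have hr' := hright (by linarith) (by linarith)
      by_cases hside' : θ ≤ l + 2 * w / 3
      -- In the middle third either decision is right, so R = 0: no error term.
      · refine ⟨0, 0, le_rfl, by rw [zero_mul]; exact hE0, fun c => Or.inl ?_⟩
        split_ifs
        · exact hleft (by linarith)
        · exact hr'
      · push Not at hside'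
        refine ⟨σ * -(1 / 80000), 1, zero_le_one, ?_, fun c => ?_⟩
        · rw [one_mul]
          refine chernoff_factor_le hp0 hp1 ?_ L ?_
          · rw [abs_mul, hσa]; norm_num [abs_of_pos]
          · have := ht.right θ hside'.le h2
            rw [mul_pow, hσ2, testRate]
            linarith
        · by_cases hc : σ * (c - L * τ) ≤ 0
          · right
            rw [one_mul]
            exact Real.one_le_exp (by nlinarith)
          · left; rw [if_neg hc]; exact hr'
    have hmain := le_prob_sample hU hθ m (S := S) (η := T * E) (by positivity) hR hk L 0
    push_cast at hmain hd ⊢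
    linarith

/-- A test on an interval of width v has (2m+1)v ≤ 1/2, so D bounds the calls of a single run at
every stage. -/
theorem cost_search_le (X L : ℕ) (a : ℝ) {D : ℝ} (T : ℕ) {l w : ℝ} (hl : 0 ≤ l) (hw : 0 < w)
    (hu : l + w ≤ 1 / 2) (hD : ∀ i < T, 1 / 2 ≤ D * ((2 / 3) ^ i * w)) :
    ((search b X L a T l w : Algorithm n b).queryCost : ℝ) ≤ T * (L * D) ∧
      ((search b X L a T l w : Algorithm n b).gateCost : ℝ)
        ≤ T * (L * (18 * (n + b + 1) * D)) := by
  induction T generalizing l w with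
  | zero => simp [search, Algorithm.queryCost, Algorithm.gateCost]
  | succ T ih =>
    have ht := isTest_chosenTest hl hw hu
    have hD' : ∀ i < T, 1 / 2 ≤ D * ((2 / 3) ^ i * (2 / 3 * w)) := by
      intro i hi
      have := hD (i + 1) (by omega)
      rwa [pow_succ, mul_assoc] at this
    obtain ⟨q1, g1⟩ := ih hl (by linarith : 0 < 2 / 3 * w) (by linarith) hD'
    obtain ⟨q2, g2⟩ := ih (by linarith : 0 ≤ l + w / 3) (by linarith : 0 < 2 / 3 * w)
      (by linarith) hD'
    have hm : 2 * ((chosenTest l w).1 : ℝ) + 1 ≤ D := by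
      have h0 := hD 0 (by omega)
      rw [pow_zero, one_mul] at h0
      exact le_of_mul_le_mul_right (ht.size.trans h0) hw
    simp only [search]
    set m := (chosenTest l w).1
    constructor
    · have h := queryCost_sample_le (b := b) X m (B := ⌊(T : ℝ) * (L * D)⌋₊)
        (k := fun c => if (chosenTest l w).2.2 * (c - L * (chosenTest l w).2.1) ≤ 0 then
          search b X L a T l (2 / 3 * w) else search b X L a T (l + w / 3) (2 / 3 * w))
        (by intro c; split_ifs <;> exact Nat.le_floor (by assumption)) L 0
      have hf := Nat.floor_le (a := (T : ℝ) * (L * D)) (le_trans (Nat.cast_nonneg _) q1)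
      have h' := (Nat.cast_le (α := ℝ)).2 h
      refine h'.trans ?_
      push_cast
      have : (L : ℝ) * (2 * m + 1) ≤ L * D := by gcongr
      linarith
    · have h := gateCost_sample_le (b := b) X m (B := ⌊(T : ℝ) * (L * (18 * (n + b + 1) * D))⌋₊)
        (k := fun c => if (chosenTest l w).2.2 * (c - L * (chosenTest l w).2.1) ≤ 0 then
          search b X L a T l (2 / 3 * w) else search b X L a T (l + w / 3) (2 / 3 * w))
        (by intro c; split_ifs <;> exact Nat.le_floor (by assumption)) L 0
      have hf := Nat.floor_le (a := (T : ℝ) * (L * (18 * (n + b + 1) * D)))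
        (le_trans (Nat.cast_nonneg _) g1)
      have h' := (Nat.cast_le (α := ℝ)).2 h
      refine h'.trans ?_
      push_cast
      have : (L : ℝ) * (18 * (n + b + 1) * (2 * m + 1)) ≤ L * (18 * (n + b + 1) * D) := by gcongr
      linarith

end Search

section Parameters

variable {n b : ℕ}

/-! ### Parameters and error bounds -/

theorem gridNormSq_pos {ψ : ℝ → ℝ} (hψ : ∀ x ∈ Icc (-1 : ℝ) 1, 0 < ψ x) : 0 < gridNormSq n ψ := by
  refine Finset.sum_pos (fun j hj => ?_) ⟨0, by simp⟩
  exact pow_pos (hψ _ (gridPoint_mem (Finset.mem_range.1 hj).le)) 2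

/-- The first column of U has norm 1, and its entries with zero ancilla have total weight a². -/
theorem le_one_of_encodes {U : OracleMatrix n b} {a : ℝ} {ψ : ℝ → ℝ}
    (h : EncodesWithSubnorm U a ψ) (hN : 0 < gridNormSq n ψ) : a ≤ 1 := by
  have hcol : ∑ z, ‖U z (zeroBits _)‖ ^ 2 = 1 := by
    have := congrFun (congrFun (Matrix.mem_unitaryGroup_iff'.1 h.1) (zeroBits _)) (zeroBits _)
    rw [Matrix.mul_apply, Matrix.one_apply_eq] at this
    have e : ∀ z, star U (zeroBits _) z * U z (zeroBits _) = ((‖U z (zeroBits _)‖ ^ 2 : ℝ) : ℂ) := by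
      intro z
      rw [Matrix.star_apply, mul_comm, Complex.star_def, Complex.mul_conj,
        Complex.normSq_eq_norm_sq]
    simp only [e] at this
    exact_mod_cast this
  have hinj : Function.Injective fun x : Fin n → Bool => Sum.elim x (zeroBits (Fin b)) := by
    intro x y hxy
    funext i
    exact congrFun hxy (Sum.inl i)
  have hle : ∑ x : Fin n → Bool, ‖U (Sum.elim x (zeroBits (Fin b))) (zeroBits _)‖ ^ 2 ≤ 1 := by
    rw [← hcol, ← Finset.sum_image (s := Finset.univ) (f := fun z => ‖U z (zeroBits _)‖ ^ 2)
      fun x _ y _ hxy => hinj hxy]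
    exact Finset.sum_le_univ_sum_of_nonneg fun z => sq_nonneg _
  have hval : ∑ x : Fin n → Bool, ‖U (Sum.elim x (zeroBits (Fin b))) (zeroBits _)‖ ^ 2 = a ^ 2 := by
    have e : ∀ x : Fin n → Bool, ‖U (Sum.elim x (zeroBits (Fin b))) (zeroBits _)‖ ^ 2
        = (fun j => a ^ 2 * (ψ (gridPoint n j) ^ 2 / gridNormSq n ψ)) (regValue x) := by
      intro x
      rw [h.2 x, Complex.norm_real, Real.norm_eq_abs, sq_abs, encodedState]
      simp only [mul_pow, div_pow, Real.sq_sqrt hN.le]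
    simp only [e]
    rw [sum_regValue fun j => a ^ 2 * (ψ (gridPoint n j) ^ 2 / gridNormSq n ψ), ← Finset.mul_sum,
      ← Finset.sum_div, ← gridNormSq, div_self hN.ne', mul_one]
  rw [hval] at hle
  nlinarith

theorem half_le_max {ψ : ℝ → ℝ} {M : ℝ} (hc : ContinuousOn ψ (Icc (-1) 1))
    (hψ : ∀ x ∈ Icc (-1 : ℝ) 1, 0 < ψ x)
    (hint : (∫ x in (-1 : ℝ)..1, ψ x ^ 2) = 1) (hM : IsGreatest (ψ '' Icc (-1) 1) M) :
    1 / 2 ≤ M := by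
  have hle : (∫ x in (-1 : ℝ)..1, ψ x ^ 2) ≤ ∫ _ in (-1 : ℝ)..1, M ^ 2 := by
    refine intervalIntegral.integral_mono_on (by norm_num) ?_ (by simp) fun x hx => ?_
    · refine ContinuousOn.intervalIntegrable ?_
      rw [uIcc_of_le (by norm_num)]
      fun_prop
    · have := hM.2 (mem_image_of_mem _ hx)
      have := hψ x hx
      gcongr
  rw [hint, intervalIntegral.integral_const] at hle
  norm_num at hle
  obtain ⟨x, hx, hxM⟩ := hM.1
  have : 0 < M := hxM ▸ hψ x hx
  nlinarith

theorem integral_sq_mem {ψ : ℝ → ℝ} {X : ℕ} (hX : X ≤ 2 ^ n) (hc : ContinuousOn ψ (Icc (-1) 1))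
    (hint : (∫ x in (-1 : ℝ)..1, ψ x ^ 2) = 1) :
    (∫ x in (-1 : ℝ)..gridPoint n X, ψ x ^ 2) ∈ Icc (0 : ℝ) 1 := by
  have hm := gridPoint_mem hX
  constructor
  · exact intervalIntegral.integral_nonneg hm.1 fun x _ => sq_nonneg _
  · refine le_of_le_of_eq ?_ hint
    refine intervalIntegral.integral_mono_interval le_rfl hm.1 hm.2 ?_ ?_
    · exact Filter.Eventually.of_forall fun x => by positivity
    · refine ContinuousOn.intervalIntegrable ?_
      rw [uIcc_of_le (by norm_num)]
      fun_prop

/-- The damping 5/13 keeps θ ≤ 1/2 even for a = p = 1, as the search requires; 5, 12, 13 being a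
Pythagorean triple keeps the gate rational. -/
theorem exists_angle {a p : ℝ} (ha : 0 < a) (ha1 : a ≤ 1) (hp0 : 0 ≤ p) (hp1 : p ≤ 1) :
    ∃ θ, 0 ≤ θ ∧ θ ≤ 1 / 2 ∧ θ ≤ 10 / 13 * a ∧ Real.sin θ ^ 2 = (5 / 13 * a) ^ 2 * p := by
  set y := 5 / 13 * a * Real.sqrt p with hy
  have hs : Real.sqrt p ≤ 1 := Real.sqrt_le_one.2 hp1
  have hs0 := Real.sqrt_nonneg p
  have hy0 : 0 ≤ y := by positivity
  have hya : y ≤ 5 / 13 * a := by nlinarith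
  have hy1 : y ≤ 5 / 13 := by linarith
  have hsin : Real.sin (Real.arcsin y) = y := Real.sin_arcsin (by linarith) (by linarith)
  have h0 : 0 ≤ Real.arcsin y := Real.arcsin_nonneg.2 hy0
  have h12 : Real.arcsin y ≤ 1 / 2 := by
    rw [Real.arcsin_le_iff_le_sin ⟨by linarith, by linarith⟩
      ⟨by linarith [Real.pi_gt_three], by linarith [Real.pi_gt_three]⟩]
    have := Real.sin_gt_sub_cube (x := 1 / 2) (by norm_num)
    norm_num at this
    linarith
  refine ⟨Real.arcsin y, h0, h12, ?_, ?_⟩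
  · have := half_le_sin h0 (by linarith)
    rw [hsin] at this
    linarith
  · rw [hsin, hy, mul_pow, Real.sq_sqrt hp0]

/-- The difference sin² l - sin² θ is at most (l + θ)|l - θ| in size. The sum is O(a), which cancels
one of the two factors 1/a. -/
theorem abs_estimate_sub_le {a p θ l w ε : ℝ} (ha : 0 < a) (hθa : θ ≤ 10 / 13 * a)
    (hθ : Real.sin θ ^ 2 = (5 / 13 * a) ^ 2 * p) (hl : 0 ≤ l) (h1 : l ≤ θ) (h2 : θ ≤ l + w)
    (hw : w ≤ a * ε / 12) : |(13 / 5 * Real.sin l / a) ^ 2 - p| ≤ ε := by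
  have hp : p = (13 / 5 / a) ^ 2 * Real.sin θ ^ 2 := by rw [hθ]; field_simp
  have e : (13 / 5 * Real.sin l / a) ^ 2 - p
      = (13 / 5 / a) ^ 2 * (Real.sin (l + θ) * Real.sin (l - θ)) := by
    rw [hp, ← sin_sq_sub_sin_sq]; ring
  have hs1 : |Real.sin (l + θ)| ≤ 20 / 13 * a := by
    refine (Real.abs_sin_le_abs).trans ?_
    rw [abs_of_nonneg (by linarith)]; linarith
  have hs2 : |Real.sin (l - θ)| ≤ a * ε / 12 := by
    refine (Real.abs_sin_le_abs).trans ?_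
    rw [abs_sub_comm, abs_of_nonneg (by linarith)]; linarith
  have hε : 0 ≤ ε := by
    have : 0 ≤ a * ε := by linarith
    exact nonneg_of_mul_nonneg_right this ha
  rw [e, abs_mul, abs_mul, abs_of_nonneg (sq_nonneg _)]
  calc _ ≤ (13 / 5 / a) ^ 2 * (20 / 13 * a * (a * ε / 12)) := by gcongr
    _ = 13 / 15 * ε := by field_simp; ring
    _ ≤ ε := by linarith

theorem exists_stages {x : ℝ} (hx : 1 ≤ x) : ∃ T : ℕ, 1 ≤ T ∧ (2 / 3) ^ T * x ≤ 1 ∧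
    (∀ i < T, 1 ≤ x * (2 / 3) ^ i) ∧ (T : ℝ) ≤ 1 + 3 * Real.log x := by
  obtain ⟨t, h1, h2⟩ := exists_nat_pow_near hx (y := (3 / 2 : ℝ)) (by norm_num)
  have hinv : ∀ k : ℕ, (3 / 2 : ℝ) ^ k * (2 / 3) ^ k = 1 := by
    intro k; rw [← mul_pow]; norm_num
  refine ⟨t + 1, by omega, ?_, ?_, ?_⟩
  · rw [← hinv (t + 1), mul_comm ((3 / 2 : ℝ) ^ (t + 1))]
    gcongr
  · intro i hi
    rw [← hinv i]
    have : (3 / 2 : ℝ) ^ i ≤ (3 / 2) ^ t := pow_le_pow_right₀ (by norm_num) (by omega)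
    gcongr
    linarith
  · have hlog := Real.log_le_log (by positivity) h1
    rw [Real.log_pow] at hlog
    have h3 : 1 / 3 ≤ Real.log (3 / 2) := by
      have := Real.one_sub_inv_le_log_of_pos (x := 3 / 2) (by norm_num)
      norm_num at this ⊢
      linarith
    push_cast
    nlinarith [(Nat.cast_nonneg t : (0 : ℝ) ≤ t)]

theorem one_le_two_mul_log_two : 1 ≤ 2 * Real.log 2 := by
  linarith [Real.log_two_gt_d9]

/-- 12y ≤ 16(2+y), log 16 = 4 log 2 and 1 ≤ 2 log 2 give 17 = 2 + 12 + 3. -/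
theorem stages_le_log {T : ℕ} {x y : ℝ} (hx : 1 ≤ x) (hT : (T : ℝ) ≤ 1 + 3 * Real.log x)
    (hxy : x ≤ 12 * y) : (T : ℝ) ≤ 17 * Real.log (2 + y) := by
  have hy : 0 < y := by linarith
  have h2 : Real.log 2 ≤ Real.log (2 + y) := Real.log_le_log (by norm_num) (by linarith)
  have h16 : Real.log 16 = 4 * Real.log 2 := by
    rw [show (16 : ℝ) = 2 ^ 4 by norm_num, Real.log_pow]; norm_num
  have h1 : Real.log x ≤ Real.log (16 * (2 + y)) := Real.log_le_log (by linarith) (by linarith)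
  rw [Real.log_mul (by norm_num) (by positivity), h16] at h1
  linarith [one_le_two_mul_log_two]

theorem log_two_div_pos {δ : ℝ} (h0 : 0 < δ) (h1 : δ < 1) : 1 ≤ 2 * Real.log (2 / δ) := by
  have : Real.log 2 ≤ Real.log (2 / δ) := by
    refine Real.log_le_log (by norm_num) ?_
    rw [le_div_iff₀ h0]; linarith
  linarith [one_le_two_mul_log_two]

theorem testRate_pos : 0 < testRate := by norm_num [testRate]

/-- The number of repetitions of each test. -/
def repetitions (T : ℕ) (δ : ℝ) : ℕ := ⌈T * Real.log (2 / δ) / testRate⌉₊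

/-- The union bound over T stages: T(δ/2)^T ≤ 2^T (δ/2)^T = δ^T ≤ δ. Repetitions proportional to T
log(2/δ) keep log(2/δ) a separate factor. -/
theorem stages_mul_exp_le {T : ℕ} {δ : ℝ} (hT : 1 ≤ T) (h0 : 0 < δ) (h1 : δ < 1) :
    T * Real.exp (-(repetitions T δ * testRate)) ≤ δ := by
  have hL : T * Real.log (2 / δ) ≤ repetitions T δ * testRate := by
    have := Nat.le_ceil (T * Real.log (2 / δ) / testRate)
    rwa [div_le_iff₀ testRate_pos] at this
  have hexp : Real.exp (-(repetitions T δ * testRate)) ≤ (δ / 2) ^ T := by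
    calc _ ≤ Real.exp (-(T * Real.log (2 / δ))) := Real.exp_le_exp.2 (by linarith)
      _ = (δ / 2) ^ T := by
        rw [← mul_neg, ← Real.log_inv, inv_div, Real.exp_nat_mul, Real.exp_log (by positivity)]
  have hT2 : (T : ℝ) ≤ 2 ^ T := by exact_mod_cast Nat.lt_two_pow_self.le
  calc _ ≤ (2 : ℝ) ^ T * (δ / 2) ^ T := by gcongr
    _ = δ ^ T := by rw [← mul_pow]; congr 1; ring
    _ ≤ δ := pow_le_of_le_one h0.le h1.le (by omega)

theorem repetitions_le {T : ℕ} {δ : ℝ} (hT : 1 ≤ T) (h0 : 0 < δ) (h1 : δ < 1) :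
    (repetitions T δ : ℝ) ≤ (1 / testRate + 2) * T * Real.log (2 / δ) := by
  have hlog := log_two_div_pos h0 h1
  have hT' : (1 : ℝ) ≤ T := by exact_mod_cast hT
  have hnn : 0 ≤ T * Real.log (2 / δ) / testRate := by
    have := testRate_pos
    apply div_nonneg _ this.le
    apply mul_nonneg <;> linarith
  have := (Nat.ceil_lt_add_one hnn).le
  change (repetitions T δ : ℝ) ≤ _ at this
  have h2 : 1 ≤ 2 * (T * Real.log (2 / δ)) := by nlinarith
  calc (repetitions T δ : ℝ) ≤ T * Real.log (2 / δ) / testRate + 1 := this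
    _ ≤ T * Real.log (2 / δ) / testRate + 2 * (T * Real.log (2 / δ)) := by linarith
    _ = _ := by ring

/-- The constant in the cost bounds. -/
def costConst : ℝ := (1 / testRate + 2) * 17 ^ 2 * 18 * 24

theorem one_le_costConst : 12 ≤ costConst := by norm_num [costConst, testRate]

theorem total_cost_le {T : ℕ} {δ x y q c : ℝ} (hT : 1 ≤ T) (h0 : 0 < δ) (h1 : δ < 1)
    (hx : 1 ≤ x) (hTx : (T : ℝ) ≤ 1 + 3 * Real.log x) (hxy : x ≤ 12 * y) (hq0 : 0 ≤ q)
    (hq : q ≤ 18 * 24 * y) (hc : c ≤ T * (repetitions T δ * q)) :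
    c ≤ costConst * y * Real.log (2 + y) ^ 2 * Real.log (2 / δ) := by
  have hlog := log_two_div_pos h0 h1
  have hTl := stages_le_log hx hTx hxy
  have hR := repetitions_le hT h0 h1
  have hr := testRate_pos
  have hT0 : (0 : ℝ) ≤ T := Nat.cast_nonneg _
  have hl0 : 0 ≤ Real.log (2 / δ) := by linarith
  have hy : 0 ≤ y := by linarith
  calc c ≤ T * (repetitions T δ * q) := hc
    _ ≤ T * ((1 / testRate + 2) * T * Real.log (2 / δ) * (18 * 24 * y)) := by gcongr
    _ = (T : ℝ) ^ 2 * ((1 / testRate + 2) * Real.log (2 / δ) * (18 * 24 * y)) := by ring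
    _ ≤ (17 * Real.log (2 + y)) ^ 2 *
        ((1 / testRate + 2) * Real.log (2 / δ) * (18 * 24 * y)) := by gcongr
    _ = _ := by rw [costConst]; ring

end Parameters

end QEstimation

end

/-! ### Choice of parameters and assembly -/

theorem mainTheorem3 :
    ∃ (C : ℝ) (k : ℕ), 0 < C ∧
      ∀ (n b X : ℕ) (a ε δ : ℝ), X < 2 ^ n → 0 < a → 0 < ε → 0 < δ → δ < 1 →
        ∃ A : QEstimation.Algorithm n b,
          ∀ (ψ : ℝ → ℝ) (Λ M : ℝ) (U : QEstimation.OracleMatrix n b),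
            AnalyticOn ℝ ψ (Set.Icc (-1) 1) →
            (∀ x ∈ Set.Icc (-1 : ℝ) 1, 0 < ψ x) →
            (∫ x in (-1 : ℝ)..1, ψ x ^ 2) = 1 →
            (∀ j ≤ 2, ∀ x ∈ Set.Icc (-1 : ℝ) 1,
              |iteratedDerivWithin j ψ (Set.Icc (-1) 1) x| ≤ Λ ^ (j + 1)) →
            IsGreatest (ψ '' Set.Icc (-1) 1) M →
            QEstimation.EncodesWithSubnorm U a ψ →
            ε ≤ n * M ^ 2 →
              1 - δ ≤ A.prob U
                {r : ℝ | |r - ∫ x in (-1 : ℝ)..QEstimation.gridPoint n X, ψ x ^ 2|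
                  ≤ ε + C * Λ ^ 2 / 2 ^ n} ∧
              (A.queryCost : ℝ) ≤
                C * ((1 / a) * ((n : ℝ) ^ 2 * M / ε)) *
                  Real.log (2 + (1 / a) * ((n : ℝ) ^ 2 * M / ε)) ^ k * Real.log (2 / δ) ∧
              (A.gateCost : ℝ) ≤
                C * ((1 / a) * (((n : ℝ) ^ 2 + b) * M / ε)) *
                  Real.log (2 + (1 / a) * (((n : ℝ) ^ 2 + b) * M / ε)) ^ k *
                    Real.log (2 / δ) := by
  refine ⟨QEstimation.costConst, 2, by linarith [QEstimation.one_le_costConst], ?_⟩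
  intro n b X a ε δ hX ha hε hδ0 hδ1
  rcases Nat.eq_zero_or_pos n with rfl | hn
  · refine ⟨.output 0, fun ψ Λ M U _ _ _ _ _ _ h => ?_⟩
    simp only [Nat.cast_zero, zero_mul] at h
    exact absurd h (not_le.2 hε)
  -- The algorithm is fixed before ψ, so trivial parameters are split off first: a > 1 admits no
  -- encoding, and for ε ≥ 1 the answer 0 is accurate enough.
  by_cases htriv : 1 < a ∨ 1 ≤ ε
  · refine ⟨.output 0, fun ψ Λ M U hψ hpos hint _ hM hU _ => ?_⟩
    have ha1 := QEstimation.le_one_of_encodes hU (QEstimation.gridNormSq_pos hpos)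
    have hε1 : 1 ≤ ε := htriv.resolve_left (not_lt.2 ha1)
    have hM0 := QEstimation.half_le_max hψ.continuousOn hpos hint hM
    have hlog := QEstimation.log_two_div_pos hδ0 hδ1
    have hC := QEstimation.one_le_costConst
    have hI := QEstimation.integral_sq_mem hX.le hψ.continuousOn hint
    have hcost : ∀ c : ℝ, 0 ≤ c → ((0 : ℕ) : ℝ) ≤ QEstimation.costConst * ((1 / a) * (c * M / ε)) *
        Real.log (2 + (1 / a) * (c * M / ε)) ^ 2 * Real.log (2 / δ) := by
      intro c hc
      have : 0 ≤ (1 / a) * (c * M / ε) := by positivity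
      have h3 : 0 ≤ Real.log (2 / δ) := by linarith
      have h4 : 0 ≤ QEstimation.costConst := by linarith
      rw [Nat.cast_zero]
      positivity
    refine ⟨?_, hcost _ (by positivity), hcost _ (by positivity)⟩
    rw [QEstimation.Algorithm.prob, if_pos]
    · linarith
    · have h5 : 0 ≤ QEstimation.costConst * Λ ^ 2 / 2 ^ n := by
        have h4 : 0 ≤ QEstimation.costConst := by linarith
        positivity
      rw [Set.mem_ofPred_eq, zero_sub, abs_neg, abs_of_nonneg hI.1]
      linarith [hI.2]
  push Not at htriv
  obtain ⟨ha1, hε1⟩ := htriv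
  have : NeZero n := ⟨hn.ne'⟩
  -- The initial width 1/2 must fall to aε/12, that is, by the factor 6/(aε).
  have hx : 1 ≤ 6 / (a * ε) := by
    rw [one_le_div (by positivity)]; nlinarith
  obtain ⟨T, hT1, hT2, hT3, hT4⟩ := QEstimation.exists_stages hx
  refine ⟨QEstimation.search b X (QEstimation.repetitions T δ) a T 0 (1 / 2), ?_⟩
  intro ψ Λ M U hψ hpos hint hder hM hU _
  have hN := QEstimation.gridNormSq_pos (n := n) hpos
  have hM0 := QEstimation.half_le_max hψ.continuousOn hpos hint hM
  have hcost := QEstimation.cost_search_le (n := n) (b := b) X (QEstimation.repetitions T δ) a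
    (D := 6 / (a * ε)) T (l := 0) (w := 1 / 2) le_rfl (by norm_num) (by norm_num)
    (fun i hi => by have := hT3 i hi; linarith)
  have hn1 : (1 : ℝ) ≤ n := by exact_mod_cast hn
  -- M ≥ 1/2 brings the factor M of the claimed bounds into play.
  have hxy : ∀ c : ℝ, 1 ≤ c → c * (6 / (a * ε)) ≤ 12 * ((1 / a) * (c * M / ε)) := by
    intro c hc
    rw [show 12 * ((1 / a) * (c * M / ε)) = c * (12 * M / (a * ε)) by field_simp]
    gcongr
    linarith
  have hxy' : ∀ c : ℝ, 1 ≤ c → 6 / (a * ε) ≤ 12 * ((1 / a) * (c * M / ε)) := by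
    intro c hc
    refine le_trans ?_ (hxy c hc)
    exact le_mul_of_one_le_left (by linarith) hc
  have hn2 : (1 : ℝ) ≤ (n : ℝ) ^ 2 := one_le_pow₀ hn1
  have hb0 : (0 : ℝ) ≤ b := Nat.cast_nonneg b
  refine ⟨?_, ?_, ?_⟩
  · set p := (∑ j ∈ Finset.range X, ψ (QEstimation.gridPoint n j) ^ 2)
      / QEstimation.gridNormSq n ψ with hp
    have hp0 : 0 ≤ p := div_nonneg (Finset.sum_nonneg fun _ _ => sq_nonneg _) hN.le
    have hp1 : p ≤ 1 := by
      rw [hp, div_le_one hN]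
      exact Finset.sum_le_sum_of_subset_of_nonneg (by simpa using hX.le) fun _ _ _ => sq_nonneg _
    have hderiv : ∀ x ∈ Set.Icc (-1 : ℝ) 1, |derivWithin ψ (Set.Icc (-1) 1) x| ≤ Λ ^ 2 := by
      intro x hx
      have := hder 1 (by norm_num) x hx
      rwa [iteratedDerivWithin_one] at this
    have hdisc := QEstimation.abs_ratio_sub_integral_le hX.le hψ.differentiableOn hderiv hint hN
    rw [← hp] at hdisc
    obtain ⟨θ, h0, h1, h2, h3⟩ := QEstimation.exists_angle ha ha1 hp0 hp1
    have hθ : Real.sin θ ^ 2 = QEstimation.goodWeight U X := by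
      rw [h3, QEstimation.goodWeight_eq hX hU hN]
    have herr := QEstimation.stages_mul_exp_le hT1 hδ0 hδ1
    refine le_trans (by linarith) (QEstimation.le_prob_search hU.1 hθ _ a T le_rfl (by norm_num)
      (by norm_num) h0 (by linarith) ?_)
    intro l g0 g1 g2
    have hw : (2 / 3 : ℝ) ^ T * (1 / 2) ≤ a * ε / 12 := by
      rw [← mul_div_assoc, div_le_one (by positivity)] at hT2
      linarith
    have hest := QEstimation.abs_estimate_sub_le ha h2 h3 g0 g1 g2 hw
    rw [Set.mem_ofPred_eq]
    have hC : 12 * Λ ^ 2 / 2 ^ n ≤ QEstimation.costConst * Λ ^ 2 / 2 ^ n := by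
      have := QEstimation.one_le_costConst
      gcongr
    exact (abs_sub_le _ p _).trans (by linarith)
  · refine QEstimation.total_cost_le hT1 hδ0 hδ1 hx hT4 (hxy' _ hn2) (by linarith) ?_ hcost.1
    have := hxy' _ hn2
    linarith
  · refine QEstimation.total_cost_le hT1 hδ0 hδ1 hx hT4 (hxy' _ (by linarith)) (by positivity) ?_
      hcost.2
    -- Uses n ≥ 1. Together with `hxy` this gives 18 · 2 · 12 = 18 · 24.
    have h4 : (n : ℝ) + b + 1 ≤ 2 * ((n : ℝ) ^ 2 + b) := by nlinarith
    have h5 : 18 * ((n : ℝ) + b + 1) * (6 / (a * ε))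
        ≤ 18 * (2 * ((n : ℝ) ^ 2 + b)) * (6 / (a * ε)) := by gcongr
    have := hxy ((n : ℝ) ^ 2 + b) (by linarith)
    linarith
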